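/- **Conventions.** $(X,\delta)$ is a finite metric space of doubling dimension at most $d$ (every ball is covered by at most $2^d$ balls of half the radius), scaled so that distinct points have distance at least $64$. Let $0<\epsilon\le\frac1{20}$, let $f\ge 1$ be an integer, and let $\mathbf B(p,r)$ be the closed ball. Let $\Delta$ be the maximum distance, $\log=\log_5$, $\zeta=\lceil\log\Delta\rceil$ (with $\zeta=0$ if $|X|\le 1$), $r_i=5^i$, $\lambda=5^{20}(1+1/\epsilon)$. A graph $G$ on a metric space, with edges weighted by distance, is a $t$-spanner if any two points $u,v$ are joined by a path in $G$ of weight at most $t\,\delta(u,v)$. A graph $H$ on $X$ is an $f$-vertex-fault-tolerant ($f$-VFT) $t$-spanner if $H$ is a $t$-spanner of $X$ and, for every $F\subseteq X$ with $|F|\le f$, the induced graph $H-F$ is a $t$-spanner of $X\setminus F$. *Net tree.* $N_0=X\supseteq N_1\supseteq\dots\supseteq N_\zeta$, where $N_i$ is an $r_i$-net of $N_{i-1}$ (its points are pairwise at distance at least $r_i$, and every point of $N_{i-1}$ is within distance $r_i$ of $N_i$). The nodes of $T$ at level $i$ are the points of $N_i$; the parent of a node of level $i-1$ is a closest point of $N_i$.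 The distance of two nodes is that of their points; $L(x)$ is the set of leaves below $x$. Two nodes $x,y$ at level $i$ form a cross edge if $\delta(x,y)\le\lambda r_i$; $NC[x]$ is the set of level-$i$ nodes at distance at most $\lambda r_i$ from $x$ (including $x$). For $j\ge i$, $\mathrm{Aug}_j(x)$ is the set of cross edges between nodes of $NC[y]$, where $y$ is the level-$j$ ancestor of $x$. The original cross edge $(\hat u,\hat v)$ of $u,v\in X$ consists of the ancestors of the leaves $u,v$ at the lowest level $i$ at which these satisfy $\delta(\hat u,\hat v)\le\lambda r_i$. *Construction.* Input: a $(1+\epsilon)$-spanner $G$ of $X$, a net tree $T$, and a parameter $\xi$. Put $c_1=50\,\xi\log\lambda$, $c_2=51\,\xi\log\lambda$, $c_3=55\,\xi\log\lambda$. Phase 1. For every edge $(u,v)$ of $G$, with original cross edge $(\hat u,\hat v)$ at level $i$, put into $E^*$ the edge $(\hat u,\hat v)$ and all $(x,y)\in\mathrm{Aug}_j(\hat u)\cup\mathrm{Aug}_j(\hat v)$ with $i\le j\le\min\{\zeta,\,i+5\log\lambda\}$ and $\delta(x,y)\ge 64r_j$. Phase 2. Start with $H=(X,\emptyset)$. For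 $i=0,\dots,\zeta-1$: (a) Mark a level-$i$ node as small if all its leaves have degree at most $c_1f$ in $H$. For each level-$i$ node $x$ that has a descendant $w$ (possibly $x$ itself), at a level in $[i-5\log\lambda,\,i]$, that was marked small and has at most $f$ leaves, add to $E^*$ all $(y,z)$ with $y,z\in NC[x]$ and $64r_i\le\delta(y,z)\le\lambda r_i$. Mark the points of degree larger than $c_3f$ in $H$ as saturated. (b) Process the level-$i$ edges $(x,y)$ of $E^*$ one by one, in arbitrary order: choose $S(x)$ and $S(y)$ as in (c), and add to $H$ all edges between $S(x)$ and $S(y)$ if one of these sets has fewer than $f+1$ elements, and an arbitrary perfect matching between them otherwise. (c) If $x$ is small, $S(x)$ consists of arbitrary $\min\{f+1,|L(x)|\}$ points of $L(x)$. Otherwise let $S'$ be the set of unsaturated points of $\mathbf B(x,16r_i)$ of current degree at least $c_2f$ in $H$, and $S''$ the set of points of $\mathbf B(x,4r_i)$ of current degree less than $c_2f$ in $H$. If $|S'|\ge f+1$, $S(x)$ consists of arbitrary $f+1$ points of $S'$; otherwise it consists of $S'$ and arbitrary $\min\{f+1-|S'|,\,|S''|\}$ points of $S''$. **Statement.** There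 is an absolute constant $C>0$ such that for all $X,d,\epsilon,f,T,G$ as above and every $\xi\ge(C/\epsilon)^d$, the construction has an output, and every possible output $H$ (whatever arbitrary choices are made) is an $f$-VFT $(1+5\epsilon)$-spanner of $X$. -/

import Mathlib

namespace FTSpanner

noncomputable section

/-! ### Spanners -/

/-- The weight of a walk in a geometric graph: every edge weighs the distance of its endpoints. -/
def walkWeight {V : Type*} [MetricSpace V] {G : SimpleGraph V} :
    ∀ {u v : V}, G.Walk u v → ℝ
  | _, _, .nil => 0
  | _, _, .cons (u := u) (v := v) _ p => dist u v + walkWeight p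

/-- `G` is a `t`-spanner of the metric space `V`. -/
def IsSpanner {V : Type*} [MetricSpace V] (G : SimpleGraph V) (t : ℝ) : Prop :=
  ∀ u v : V, ∃ p : G.Walk u v, walkWeight p ≤ t * dist u v

/-- `H` is an `f`-vertex-fault-tolerant `t`-spanner: it is a `t`-spanner, and for every set `F` of
at most `f` points the induced graph `H - F` is a `t`-spanner of the metric space `X ∖ F`. -/
def IsVFTSpanner {X : Type*} [MetricSpace X] (H : SimpleGraph X) (f : ℕ) (t : ℝ) : Prop :=
  IsSpanner H t ∧ ∀ F : Finset X, F.card ≤ f → IsSpanner (H.induce {x : X | x ∉ F}) t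

/-- The doubling dimension of `X` is at most `d`: every ball is covered by at most `2 ^ d` balls of
half the radius. -/
def DoublingDimLE (X : Type*) [MetricSpace X] (d : ℝ) : Prop :=
  ∀ (p : X) (R : ℝ), 0 < R → ∃ C : Finset X, (C.card : ℝ) ≤ (2 : ℝ) ^ d ∧
    Metric.closedBall p R ⊆ ⋃ c ∈ C, Metric.closedBall c (R / 2)

/-! ### The greedy net tree -/

/-- The radius of the nodes at level `i`. -/
def rad (i : ℕ) : ℝ := 5 ^ i

/-- The top level `ζ = ⌈log₅ Δ⌉`, where `Δ` is the maximum distance. -/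
def topLevel (X : Type*) [MetricSpace X] : ℕ :=
  ⌈Real.logb 5 (Metric.diam (Set.univ : Set X))⌉₊

/-- `N` is an `r`-net of `P`. -/
def IsNet {X : Type*} [MetricSpace X] (N P : Set X) (r : ℝ) : Prop :=
  N ⊆ P ∧ (∀ p ∈ N, ∀ q ∈ N, p ≠ q → r ≤ dist p q) ∧ ∀ p ∈ P, ∃ q ∈ N, dist p q ≤ r

/-- A greedy net tree.  The nodes at level `i ≤ ζ` are the pairs `(p, i)` with `p ∈ net i`, and
`parent i p` is the parent (at level `i + 1`) of the node `(p, i)`.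
Only the values at levels up to `ζ` are meaningful. -/
structure NetTree (X : Type*) [MetricSpace X] where
  net : ℕ → Set X
  parent : ℕ → X → X
  net_zero : net 0 = Set.univ
  net_succ : ∀ i < topLevel X, IsNet (net (i + 1)) (net i) (rad (i + 1))
  parent_mem : ∀ i < topLevel X, ∀ p ∈ net i, parent i p ∈ net (i + 1)
  parent_closest : ∀ i < topLevel X, ∀ p ∈ net i, ∀ q ∈ net (i + 1),
    dist p (parent i p) ≤ dist p q

section Algorithm

variable {X : Type*} [MetricSpace X]

/-- `T.ancestor j k p` is the ancestor at level `j + k` of the node `(p, j)`. -/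
def NetTree.ancestor (T : NetTree X) (j : ℕ) : ℕ → X → X
  | 0, p => p
  | k + 1, p => T.parent (j + k) (T.ancestor j k p)

/-- The set of leaves of the subtree rooted at the node `(x, i)`. -/
def NetTree.leaves (T : NetTree X) (i : ℕ) (x : X) : Set X :=
  {v | T.ancestor 0 i v = x}

/-! ### Cross edges -/

/-- `λ = 5²⁰ (1 + 1 / ε)`. -/
def lam (ε : ℝ) : ℝ := 5 ^ 20 * (1 + 1 / ε)

/-- `log₅ λ`. -/
def logLam (ε : ℝ) : ℝ := Real.logb 5 (lam ε)

/-- The closed cross neighbourhood `NC[x]` of the node `(x, i)`. -/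
def NetTree.NC (T : NetTree X) (ε : ℝ) (i : ℕ) (x : X) : Set X :=
  {y | y ∈ T.net i ∧ dist x y ≤ lam ε * rad i}

/-- The set of cross edges between level-`i` nodes in `A`. -/
def NetTree.crossEdges (T : NetTree X) (ε : ℝ) (i : ℕ) (A : Set X) : Set (Sym2 X) :=
  {e | ∃ y ∈ A, ∃ z ∈ A, y ∈ T.net i ∧ z ∈ T.net i ∧ dist y z ≤ lam ε * rad i ∧ e = s(y, z)}

/-- The augmented cross edges at level `j ≥ i` of the node `(x, i)`: the cross edges within
`NC[y]`, where `y` is the ancestor of `(x, i)` at level `j`. -/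
def NetTree.aug (T : NetTree X) (ε : ℝ) (i : ℕ) (x : X) (j : ℕ) : Set (Sym2 X) :=
  T.crossEdges ε j (T.NC ε j (T.ancestor i (j - i) x))

/-- `i` is the level of the original cross edge of `(u, 0)` and `(v, 0)`, that is, the lowest level
at which their ancestors are within distance `λ rᵢ`. -/
def NetTree.IsOriginalLevel (T : NetTree X) (ε : ℝ) (u v : X) (i : ℕ) : Prop :=
  i ≤ topLevel X ∧
  dist (T.ancestor 0 i u) (T.ancestor 0 i v) ≤ lam ε * rad i ∧
  ∀ j < i, lam ε * rad j < dist (T.ancestor 0 j u) (T.ancestor 0 j v)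

/-- The level-`j` edges that the first phase puts into `E*`: the original cross edges `(û, v̂)` of
the edges `(u, v)` of `G`, and the augmented cross edges of length at least `64 rⱼ` of `û` and of
`v̂` at the levels `j` from the level `i` of `û`, `v̂` up to `i + 5 log λ`. -/
def phaseOneEdges (T : NetTree X) (G : SimpleGraph X) (ε : ℝ) (j : ℕ) : Set (Sym2 X) :=
  {e | ∃ u v i, G.Adj u v ∧ T.IsOriginalLevel ε u v i ∧
    ((j = i ∧ e = s(T.ancestor 0 i u, T.ancestor 0 i v)) ∨
     (i ≤ j ∧ j ≤ topLevel X ∧ (j : ℝ) ≤ (i : ℝ) + 5 * logLam ε ∧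
      (e ∈ T.aug ε i (T.ancestor 0 i u) j ∨ e ∈ T.aug ε i (T.ancestor 0 i v) j) ∧
      ∃ y z, e = s(y, z) ∧ 64 * rad j ≤ dist y z))}

/-! ### The second phase

`H i` is the graph at the beginning of iteration `i`; `ξ` is the parameter on which the degree
thresholds depend. -/

def c₁ (ε ξ : ℝ) : ℝ := 50 * logLam ε * ξ

def c₂ (ε ξ : ℝ) : ℝ := 51 * logLam ε * ξ

def c₃ (ε ξ : ℝ) : ℝ := 55 * logLam ε * ξ

/-- The degree of `v` in `H`. -/
def deg (H : SimpleGraph X) (v : X) : ℕ := (H.neighborSet v).ncard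

/-- The node `(x, i)` is marked as small in iteration `i`, at the beginning of which the graph is
`Hᵢ`: every leaf of `(x, i)` has degree at most `c₁ f` in `Hᵢ`. -/
def IsSmall (T : NetTree X) (f : ℕ) (ε ξ : ℝ) (Hᵢ : SimpleGraph X) (i : ℕ) (x : X) : Prop :=
  ∀ v ∈ T.leaves i x, (deg Hᵢ v : ℝ) ≤ c₁ ε ξ * f

/-- The level-`i` edges that iteration `i` adds to `E*`: if a node `(x, i)` has a descendant
`(w, j)` (possibly itself) with `i - 5 log λ ≤ j ≤ i` that was marked as small (in iteration `j`)
and has at most `f` leaves, then all `(y, z)` with `y, z ∈ NC[x]` and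
`64 rᵢ ≤ δ(y, z) ≤ λ rᵢ` are added. -/
def phaseTwoEdges (T : NetTree X) (f : ℕ) (ε ξ : ℝ) (H : ℕ → SimpleGraph X) (i : ℕ) :
    Set (Sym2 X) :=
  {e | ∃ x ∈ T.net i,
    (∃ j ≤ i, (i : ℝ) - 5 * logLam ε ≤ j ∧ ∃ w ∈ T.net j, T.ancestor j (i - j) w = x ∧
      IsSmall T f ε ξ (H j) j w ∧ (T.leaves j w).ncard ≤ f) ∧
    ∃ y ∈ T.NC ε i x, ∃ z ∈ T.NC ε i x,
      64 * rad i ≤ dist y z ∧ dist y z ≤ lam ε * rad i ∧ e = s(y, z)}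

/-- The set `E*ᵢ` of the level-`i` edges of `E*` when iteration `i` processes them. -/
def EStar (T : NetTree X) (G : SimpleGraph X) (f : ℕ) (ε ξ : ℝ) (H : ℕ → SimpleGraph X) (i : ℕ) :
    Set (Sym2 X) :=
  phaseOneEdges T G ε i ∪ phaseTwoEdges T f ε ξ H i

/-- `v` is marked as saturated when the edges of `E*ᵢ` are processed.  The marks are set at the
beginning of the iterations; degrees never decrease, so the marks set in earlier iterations are
among those set in iteration `i`. -/
def IsSaturated (f : ℕ) (ε ξ : ℝ) (Hᵢ : SimpleGraph X) (v : X) : Prop :=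
  c₃ ε ξ * f < deg Hᵢ v

/-- The set `S'` of candidates in `SelectSurrogate`; `Hc` is the current graph. -/
def semiSaturated (f : ℕ) (ε ξ : ℝ) (Hᵢ Hc : SimpleGraph X) (i : ℕ) (x : X) : Set X :=
  {u | dist x u ≤ 16 * rad i ∧ c₂ ε ξ * f ≤ deg Hc u ∧ ¬ IsSaturated f ε ξ Hᵢ u}

/-- The set `S''` of candidates in `SelectSurrogate`; `Hc` is the current graph. -/
def clean (f : ℕ) (ε ξ : ℝ) (Hc : SimpleGraph X) (i : ℕ) (x : X) : Set X :=
  {u | dist x u ≤ 4 * rad i ∧ (deg Hc u : ℝ) < c₂ ε ξ * f}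

/-- `S` is a possible result of `SelectSurrogate` for the node `(x, i)`, where `Hᵢ` is the graph at
the beginning of iteration `i` and `Hc` the current graph.  If a set from which a number of elements
is to be chosen has fewer elements, all of them are taken. -/
def IsSurrogateSet (T : NetTree X) (f : ℕ) (ε ξ : ℝ) (Hᵢ Hc : SimpleGraph X) (i : ℕ) (x : X)
    (S : Set X) : Prop :=
  (IsSmall T f ε ξ Hᵢ i x →
    S ⊆ T.leaves i x ∧ S.ncard = min (f + 1) (T.leaves i x).ncard) ∧
  (¬ IsSmall T f ε ξ Hᵢ i x →
    let S' := semiSaturated f ε ξ Hᵢ Hc i x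
    let S'' := clean f ε ξ Hc i x
    (f + 1 ≤ S'.ncard → S ⊆ S' ∧ S.ncard = f + 1) ∧
    (S'.ncard < f + 1 →
      ∃ A ⊆ S'', A.ncard = min (f + 1 - S'.ncard) S''.ncard ∧ S = S' ∪ A))

/-- `M` is a possible bipartite connection of the surrogate sets `S₁` and `S₂`: all edges between
them if one of them has fewer than `f + 1` elements, and a perfect matching otherwise. -/
def IsBipartiteConnection (f : ℕ) (S₁ S₂ : Set X) (M : Set (Sym2 X)) : Prop :=
  (min S₁.ncard S₂.ncard < f + 1 → M = {e | ∃ u ∈ S₁, ∃ v ∈ S₂, e = s(u, v)}) ∧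
  (f + 1 ≤ min S₁.ncard S₂.ncard →
    ∃ φ : X → X, Set.BijOn φ S₁ S₂ ∧ M = {e | ∃ u ∈ S₁, e = s(u, φ u)})

/-- Processing the cross edges of a list, in this order, turns the current graph `Hc` into `H'`. -/
inductive ProcessEdges (T : NetTree X) (f : ℕ) (ε ξ : ℝ) (Hᵢ : SimpleGraph X) (i : ℕ) :
    SimpleGraph X → List (X × X) → SimpleGraph X → Prop
  | nil (Hc : SimpleGraph X) : ProcessEdges T f ε ξ Hᵢ i Hc [] Hc
  | cons (Hc H' : SimpleGraph X) (x y : X) (l : List (X × X)) (S₁ S₂ : Set X) (M : Set (Sym2 X))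
      (h₁ : IsSurrogateSet T f ε ξ Hᵢ Hc i x S₁) (h₂ : IsSurrogateSet T f ε ξ Hᵢ Hc i y S₂)
      (hM : IsBipartiteConnection f S₁ S₂ M)
      (h : ProcessEdges T f ε ξ Hᵢ i (Hc ⊔ SimpleGraph.fromEdgeSet M) l H') :
      ProcessEdges T f ε ξ Hᵢ i Hc ((x, y) :: l) H'

/-- `H` is a possible output of the spanner construction for the net tree `T` and the spanner `G`:
starting from the graph without edges, iteration `i` (for `i = 0, …, ζ - 1`) processes every edge
of `E*ᵢ` once, in an arbitrary order. -/
def IsOutput (T : NetTree X) (G : SimpleGraph X) (f : ℕ) (ε ξ : ℝ) (H : SimpleGraph X) : Prop :=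
  ∃ Hs : ℕ → SimpleGraph X, Hs 0 = ⊥ ∧ Hs (topLevel X) = H ∧
    ∀ i < topLevel X, ∃ l : List (X × X),
      (l.map fun p => s(p.1, p.2)).Nodup ∧
      (∀ e : Sym2 X, e ∈ (l.map fun p => s(p.1, p.2)) ↔ e ∈ EStar T G f ε ξ Hs i) ∧
      ProcessEdges T f ε ξ (Hs i) i (Hs i) l (Hs (i + 1))

end Algorithm

end

end FTSpanner

/-!
Every possible output `H` of the construction is a fault-tolerant spanner for two reasons.

*Surrogate sets do not fail.* The surrogate set of a node that is not small always has `f + 1`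
points (`IsRun.ncard_eq_of_not_isSmall`), so that it contains a point outside any set `F` of `f`
faults. This follows from the invariant `IsRun.cleanAbundant`: around every point whose degree
exceeds `c₁ f` there are at least `3f + 2` clean points, that is, points of degree less than `c₂
f`. The invariant is proved by induction on the level, and three facts carry the proof. By
packing, a degree grows by at most `ξ f` in one iteration (`IsRun.deg_succ_le`). The edges that
are new in iteration `j ≥ 1` have length between `32 rⱼ` and `(λ + 32) rⱼ`
(`IsRun.dist_of_new_adj`). Points become non-clean ("are promoted") only where there are at most
`f` semi-saturated points (`IsRun.ncard_le_of_promoted`). The critical case is that of a point `w`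
that has just been promoted (`IsRun.le_ncard_cleanBall_of_promoted`). If there were few clean
points around `w`, then almost all points there would be saturated. The last one of them to be
promoted, `z`, has since then gained about `4 ξ f log λ` neighbours, all of them far from `z` in
comparison with the radius at the time of its promotion. One of these neighbours is saturated;
together with `z` it gives two disjoint balls with `3f + 2` clean points each, and some of these
points would have to be promoted later than `z`.

*Dead nodes can be bypassed.* A node that is small and whose leaves are all in `F` is of no use,
but then the second phase adds all long cross edges around its ancestors. Given `u` and `v`, let
`π` be a light path of `G` from `u` to `v`, and let `i` be a level such that the weight of `π` is
comparable to `λ rᵢ`. If the cross edge of the ends of `π` at level `i` is in `E*`, then one of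
the edges that realize it survives. If it is not, then neither phase has added it, which means
that the edges of `π` are much shorter than `rᵢ` and that all nodes along `π` at level `i - 1` are
alive; then `π` is cut into pieces of weight comparable to `λ rᵢ₋₁`, and the argument is repeated
for each piece (`IsRun.linked_of_walk`). The surviving edges of consecutive pieces have ends near
a common point of `π`, at a distance that is negligible compared to `ε` times the weight of the
pieces, and they are connected by induction on the distance of the pair `u`, `v` (`IsRun.joined`).
-/

namespace FTSpanner

/-! ### Weighted walks -/

section Walks

variable {V : Type*} [MetricSpace V] {G : SimpleGraph V}

theorem walkWeight_nonneg {u v : V} (p : G.Walk u v) : 0 ≤ walkWeight p := by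
  induction p with
  | nil => simp [walkWeight]
  | cons h p ih => simp only [walkWeight]; positivity

theorem walkWeight_append {u v w : V} (p : G.Walk u v) (q : G.Walk v w) :
    walkWeight (p.append q) = walkWeight p + walkWeight q := by
  induction p with
  | nil => simp [walkWeight]
  | cons h p ih => simp only [walkWeight, SimpleGraph.Walk.cons_append, ih]; ring

theorem dist_le_walkWeight {u v : V} (p : G.Walk u v) : dist u v ≤ walkWeight p := by
  induction p with
  | nil => simp [walkWeight]
  | cons h p ih =>
    simp only [walkWeight]
    exact (dist_triangle _ _ _).trans (by gcongr)

theorem dist_le_walkWeight_of_mem_support {u v : V} (p : G.Walk u v) :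
    ∀ x ∈ p.support, dist u x ≤ walkWeight p := by
  induction p with
  | nil => simp [walkWeight]
  | cons h p ih =>
    intro x hx
    simp only [walkWeight]
    rcases List.mem_cons.1 (by simpa using hx) with rfl | hx
    · rw [dist_self]; exact add_nonneg dist_nonneg (walkWeight_nonneg p)
    · exact (dist_triangle _ _ _).trans (by gcongr; exact ih x hx)

theorem dist_le_walkWeight_of_mem_support_right {u v : V} (p : G.Walk u v) :
    ∀ x ∈ p.support, dist x v ≤ walkWeight p := by
  induction p with
  | nil => simp [walkWeight]
  | cons h p ih =>
    intro x hx
    rcases List.mem_cons.1 (by simpa using hx) with rfl | hx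
    · exact dist_le_walkWeight (.cons h p)
    · exact (ih x hx).trans (le_add_of_nonneg_left dist_nonneg)

theorem dist_le_walkWeight_of_mem_darts {u v : V} (p : G.Walk u v) :
    ∀ d ∈ p.darts, dist d.fst d.snd ≤ walkWeight p := by
  induction p with
  | nil => simp
  | cons h p ih =>
    intro d hd
    simp only [walkWeight]
    rcases List.mem_cons.1 (by simpa using hd) with rfl | hd
    · exact le_add_of_nonneg_right (walkWeight_nonneg p)
    · exact (ih d hd).trans (le_add_of_nonneg_left dist_nonneg)

/-- A walk whose edges have length at most `τ` has a prefix of weight in `(θ, θ + τ]`. -/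
theorem exists_walk_split {τ : ℝ} {u v : V} (p : G.Walk u v)
    (hτ : ∀ d ∈ p.darts, dist d.fst d.snd ≤ τ) {θ : ℝ} (hθ : 0 ≤ θ) (h : θ < walkWeight p) :
    ∃ (m : V) (q : G.Walk u m) (q' : G.Walk m v),
      p = q.append q' ∧ θ < walkWeight q ∧ walkWeight q ≤ θ + τ := by
  induction p generalizing θ with
  | nil => simp only [walkWeight] at h; exact absurd h (not_lt.2 hθ)
  | @cons a b c hab p ih =>
    have hd : dist a b ≤ τ := hτ ⟨(a, b), hab⟩ (by simp)
    rcases lt_or_ge θ (dist a b) with hlt | hge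
    · exact ⟨b, .cons hab .nil, p, by simp, by simpa [walkWeight] using hlt,
        by simp only [walkWeight]; linarith⟩
    · simp only [walkWeight] at h
      obtain ⟨m, q, q', rfl, h₁, h₂⟩ := ih (fun d hd => hτ d (by simp [hd]))
        (sub_nonneg.2 hge) (by linarith : θ - dist a b < walkWeight p)
      exact ⟨m, .cons hab q, q', by simp, by simp only [walkWeight]; linarith,
        by simp only [walkWeight]; linarith⟩

/-- To prove an additive property of a walk with short edges, it suffices to prove it for the walks
of weight between `θ` and `10 θ`, into which the walk can be cut. -/
theorem walk_induction_pieces {R : V → V → ℝ → Prop}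
    (htrans : ∀ {a b c w w'}, R a b w → R b c w' → R a c (w + w')) {θ B : ℝ} (hθ : 0 ≤ θ)
    {P : V → Prop}
    (hbase : ∀ {a b} (p : G.Walk a b), P a → P b → θ < walkWeight p → walkWeight p ≤ 10 * θ →
      walkWeight p ≤ B → R a b (walkWeight p))
    {a b : V} (p : G.Walk a b) (hd : ∀ d ∈ p.darts, dist d.fst d.snd ≤ θ)
    (hs : ∀ x ∈ p.support, P x) (h : θ < walkWeight p) (hB : walkWeight p ≤ B) :
    R a b (walkWeight p) := by
  induction hn : p.length using Nat.strong_induction_on generalizing a p with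
  | _ n ih =>
  rcases le_or_gt (walkWeight p) (10 * θ) with hle | hlt
  · exact hbase p (hs _ p.start_mem_support) (hs _ p.end_mem_support) h hle hB
  · obtain ⟨m, q, q', rfl, h₁, h₂⟩ := exists_walk_split p hd hθ h
    rw [walkWeight_append] at *
    have hq := walkWeight_nonneg q
    have hq' := walkWeight_nonneg q'
    have hlen : 0 < q.length := by
      cases q with
      | nil => simp only [walkWeight] at h₁; exact absurd h₁ (not_lt.2 hθ)
      | cons => simp
    have hsupp : ∀ x, x ∈ q.support ∨ x ∈ q'.support → P x := fun x hx =>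
      hs x ((SimpleGraph.Walk.mem_support_append_iff _ _).2 hx)
    refine htrans (hbase q (hsupp _ (.inl q.start_mem_support)) (hsupp _ (.inl q.end_mem_support))
      h₁ (by linarith) (by linarith)) (ih q'.length ?_ q' (fun d hd' => hd d ?_)
        (fun x hx => hsupp x (.inr hx)) (by linarith) (by linarith) rfl)
    · rw [← hn, SimpleGraph.Walk.length_append]; omega
    · rw [SimpleGraph.Walk.darts_append]; exact List.mem_append_right _ hd'

theorem walkWeight_map {W : Type*} [MetricSpace W] {G' : SimpleGraph W} (φ : G →g G')
    (hφ : ∀ a b, dist (φ a) (φ b) = dist a b) {u v : V} (p : G.Walk u v) :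
    walkWeight (p.map φ) = walkWeight p := by
  induction p with
  | nil => simp [walkWeight]
  | cons h p ih => simp only [SimpleGraph.Walk.map_cons, walkWeight, ih, hφ]

end Walks

section Joined

variable {X : Type*} [MetricSpace X] {H : SimpleGraph X} {F : Finset X}

/-- `a` and `b` are points outside `F` that are joined by a walk of weight at most `w` in
`H - F`. -/
def Joined (H : SimpleGraph X) (F : Finset X) (a b : X) (w : ℝ) : Prop :=
  ∃ (ha : a ∈ {x : X | x ∉ F}) (hb : b ∈ {x : X | x ∉ F})
    (p : (H.induce {x : X | x ∉ F}).Walk ⟨a, ha⟩ ⟨b, hb⟩), walkWeight p ≤ w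

theorem Joined.mono {a b : X} {w w' : ℝ} (h : Joined H F a b w) (hw : w ≤ w') :
    Joined H F a b w' := by
  obtain ⟨ha, hb, p, hp⟩ := h
  exact ⟨ha, hb, p, hp.trans hw⟩

theorem Joined.trans {a b c : X} {w w' : ℝ} (h : Joined H F a b w) (h' : Joined H F b c w') :
    Joined H F a c (w + w') := by
  obtain ⟨ha, hb, p, hp⟩ := h
  obtain ⟨_, hc, q, hq⟩ := h'
  exact ⟨ha, hc, p.append q, by rw [walkWeight_append]; linarith⟩

theorem Joined.refl {a : X} (ha : a ∉ F) : Joined H F a a 0 :=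
  ⟨ha, ha, .nil, by simp [walkWeight]⟩

theorem Joined.of_adj {a b : X} (ha : a ∉ F) (hb : b ∉ F) (h : H.Adj a b) :
    Joined H F a b (dist a b) :=
  ⟨ha, hb, .cons (v := ⟨b, hb⟩) (by simpa using h) .nil,
    by simp [walkWeight, Subtype.dist_eq]⟩

theorem isVFTSpanner_of_joined {f : ℕ} {t : ℝ}
    (h : ∀ F : Finset X, F.card ≤ f → ∀ u v, u ∉ F → v ∉ F → Joined H F u v (t * dist u v)) :
    IsVFTSpanner H f t := by
  refine ⟨fun u v => ?_, fun F hF u v => ?_⟩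
  · obtain ⟨hu, hv, p, hp⟩ := h ∅ (by simp) u v (by simp) (by simp)
    have hmap := walkWeight_map
      (SimpleGraph.Embedding.induce (G := H) {x | x ∉ (∅ : Finset X)}).toHom (fun _ _ => rfl) p
    exact ⟨p.map (SimpleGraph.Embedding.induce (G := H) {x | x ∉ (∅ : Finset X)}).toHom,
      hmap.trans_le hp⟩
  · obtain ⟨_, _, p, hp⟩ := h F hF u v u.2 v.2
    exact ⟨p, hp⟩

end Joined

/-! ### Packing in doubling spaces -/

section Packing

variable {X : Type*} [MetricSpace X] {d : ℝ}

theorem DoublingDimLE.exists_cover (h : DoublingDimLE X d) (n : ℕ) (p : X) {R : ℝ} (hR : 0 < R) :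
    ∃ C : Finset X, (C.card : ℝ) ≤ ((2 : ℝ) ^ d) ^ n ∧
      Metric.closedBall p R ⊆ ⋃ c ∈ C, Metric.closedBall c (R / 2 ^ n) := by
  classical
  induction n with
  | zero => exact ⟨{p}, by simp, by simp⟩
  | succ n ih =>
    obtain ⟨C, hC, hcov⟩ := ih
    choose D hD hDcov using fun c : X => h c (R / 2 ^ n) (by positivity)
    refine ⟨C.biUnion D, ?_, fun x hx => ?_⟩
    · calc ((C.biUnion D).card : ℝ) ≤ ∑ c ∈ C, ((D c).card : ℝ) := by
            exact_mod_cast Finset.card_biUnion_le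
        _ ≤ ∑ c ∈ C, (2 : ℝ) ^ d := Finset.sum_le_sum fun c _ => hD c
        _ = C.card * (2 : ℝ) ^ d := by simp
        _ ≤ ((2 : ℝ) ^ d) ^ n * (2 : ℝ) ^ d := by gcongr
        _ = _ := (pow_succ _ _).symm
    · obtain ⟨c, hc, hxc⟩ := Set.mem_iUnion₂.1 (hcov hx)
      obtain ⟨e, he, hxe⟩ := Set.mem_iUnion₂.1 (hDcov c hxc)
      refine Set.mem_iUnion₂.2 ⟨e, Finset.mem_biUnion.2 ⟨c, hc, he⟩, ?_⟩
      rwa [pow_succ, ← div_div]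

/-- An `r`-separated subset of a ball of radius `R ≥ r` has at most `(4R/r)^d` points. -/
theorem DoublingDimLE.ncard_le_of_separated (h : DoublingDimLE X d) (hd : 0 ≤ d) {P : Set X}
    {p : X} {r R : ℝ} (hr : 0 < r) (hrR : r ≤ R) (hP : ∀ x ∈ P, dist p x ≤ R)
    (hsep : ∀ x ∈ P, ∀ y ∈ P, x ≠ y → r ≤ dist x y) : (P.ncard : ℝ) ≤ (4 * R / r) ^ d := by
  have hR : 0 < R := hr.trans_le hrR
  obtain ⟨n, hn, hn'⟩ := exists_nat_pow_near (x := 2 * R / r) (y := 2)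
    (by rw [le_div_iff₀ hr]; linarith) one_lt_two
  obtain ⟨C, hC, hcov⟩ := h.exists_cover (n + 1) p hR
  have hsmall : R / 2 ^ (n + 1) < r / 2 := by
    rw [div_lt_iff₀ hr] at hn'
    rw [div_lt_iff₀ (by positivity)]
    linarith
  have hex : ∀ x : X, ∃ c, x ∈ P → c ∈ C ∧ dist x c ≤ R / 2 ^ (n + 1) := by
    intro x
    by_cases hx : x ∈ P
    · obtain ⟨c, hc, hxc⟩ := Set.mem_iUnion₂.1
        (hcov (by rw [Metric.mem_closedBall, dist_comm]; exact hP x hx))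
      exact ⟨c, fun _ => ⟨hc, hxc⟩⟩
    · exact ⟨x, fun hx' => absurd hx' hx⟩
  choose g hg using hex
  have hinj : Set.InjOn g P := by
    intro x hx y hy hxy
    by_contra hne
    have h₁ := (hg x hx).2
    have h₂ := (hg y hy).2
    rw [← hxy] at h₂
    have := hsep x hx y hy hne
    linarith [dist_triangle_right x y (g x)]
  have hcard : P.ncard ≤ C.card := by
    rw [← Set.ncard_coe_finset C]
    exact Set.ncard_le_ncard_of_injOn g (fun x hx => (hg x hx).1) hinj C.finite_toSet
  calc (P.ncard : ℝ) ≤ C.card := by exact_mod_cast hcard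
    _ ≤ ((2 : ℝ) ^ d) ^ (n + 1) := hC
    _ = ((2 : ℝ) ^ (n + 1)) ^ d := by
      rw [← Real.rpow_natCast, ← Real.rpow_mul (by norm_num), mul_comm, Real.rpow_mul (by norm_num),
        Real.rpow_natCast]
    _ ≤ (4 * R / r) ^ d := by
      refine Real.rpow_le_rpow (by positivity) ?_ hd
      rw [pow_succ]
      calc (2 : ℝ) ^ n * 2 ≤ 2 * R / r * 2 := by gcongr
        _ = _ := by ring

/-- A closest pair of points shows that the doubling dimension of a finite space with at least two
points is at least one. -/
theorem DoublingDimLE.one_le [Finite X] [Nontrivial X] (h : DoublingDimLE X d) : 1 ≤ d := by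
  obtain ⟨⟨a, b⟩, hab, hmin⟩ := (Set.toFinite {q : X × X | q.1 ≠ q.2}).exists_minimalFor
    (fun q => dist q.1 q.2) _ (by obtain ⟨a, b, hab⟩ := exists_pair_ne X; exact ⟨(a, b), hab⟩)
  have hab' : a ≠ b := hab
  have hpos : 0 < dist a b := dist_pos.2 hab'
  have hmin' : ∀ x y : X, x ≠ y → dist a b ≤ dist x y := by
    intro x y hxy
    by_contra hlt
    exact hlt (hmin (j := (x, y)) hxy (not_le.1 hlt).le)
  obtain ⟨C, hC, hcov⟩ := h a (dist a b) hpos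
  have hmem : ∀ x, dist a x ≤ dist a b → x ∈ C := by
    intro x hx
    obtain ⟨c, hc, hxc⟩ := Set.mem_iUnion₂.1
      (hcov (by rwa [Metric.mem_closedBall, dist_comm] : x ∈ Metric.closedBall a (dist a b)))
    by_contra hxC
    have hne : x ≠ c := fun e => hxC (e ▸ hc)
    have := hmin' x c hne
    rw [Metric.mem_closedBall] at hxc
    linarith
  have h2 : 1 < C.card := Finset.one_lt_card.2
    ⟨a, hmem a (by simp [dist_nonneg]), b, hmem b le_rfl, hab'⟩
  have h3 : (2 : ℝ) ^ (1 : ℝ) ≤ 2 ^ d := by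
    rw [Real.rpow_one]
    exact le_trans (by exact_mod_cast h2) hC
  exact (Real.rpow_le_rpow_left_iff one_lt_two).1 h3

end Packing

/-! ### Geometry of the net tree -/

section Tree

variable {X : Type*} [MetricSpace X]

theorem rad_pos (i : ℕ) : 0 < rad i := by unfold rad; positivity

theorem rad_succ (i : ℕ) : rad (i + 1) = 5 * rad i := by unfold rad; rw [pow_succ]; ring

theorem rad_add (i k : ℕ) : rad (i + k) = rad i * 5 ^ k := by unfold rad; rw [pow_add]

theorem rad_mono {i j : ℕ} (h : i ≤ j) : rad i ≤ rad j :=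
  pow_le_pow_right₀ (by norm_num) h

theorem rad_mul_five_le {i j : ℕ} (h : i < j) : 5 * rad i ≤ rad j := by
  rw [← rad_succ]; exact rad_mono h

namespace NetTree

variable (T : NetTree X)

theorem ancestor_add (j k : ℕ) (v : X) :
    T.ancestor 0 (j + k) v = T.ancestor j k (T.ancestor 0 j v) := by
  induction k with
  | zero => rfl
  | succ k ih =>
    change T.parent (0 + (j + k)) (T.ancestor 0 (j + k) v) = T.parent (j + k) _
    rw [ih, zero_add]

theorem ancestor_mem (v : X) {i : ℕ} (hi : i ≤ topLevel X) : T.ancestor 0 i v ∈ T.net i := by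
  induction i with
  | zero => simp [T.net_zero]
  | succ i ih =>
    have := T.parent_mem i hi _ (ih (by omega))
    simpa [ancestor] using this

theorem dist_parent_le {i : ℕ} (hi : i < topLevel X) {p : X} (hp : p ∈ T.net i) :
    dist p (T.parent i p) ≤ rad (i + 1) := by
  obtain ⟨q, hq, hpq⟩ := (T.net_succ i hi).2.2 p hp
  exact (T.parent_closest i hi p hp q hq).trans hpq

theorem dist_ancestor_le (v : X) {i : ℕ} (hi : i ≤ topLevel X) :
    dist v (T.ancestor 0 i v) ≤ 5 / 4 * rad i := by
  induction i with
  | zero => norm_num [ancestor, rad]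
  | succ i ih =>
    have h₁ := ih (by omega)
    have h₂ := T.dist_parent_le hi (T.ancestor_mem v (i := i) (by omega))
    have h₃ := dist_triangle v (T.ancestor 0 i v) (T.parent i (T.ancestor 0 i v))
    have h₄ : T.ancestor 0 (i + 1) v = T.parent i (T.ancestor 0 i v) := by simp [ancestor]
    rw [h₄]
    rw [rad_succ] at h₂ ⊢
    linarith

theorem dist_ancestor_ancestor_le (u v : X) {i : ℕ} (hi : i ≤ topLevel X) :
    dist (T.ancestor 0 i u) (T.ancestor 0 i v) ≤ dist u v + 5 / 2 * rad i := by
  have h₁ := T.dist_ancestor_le u hi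
  have h₂ := T.dist_ancestor_le v hi
  have h₃ := dist_triangle4 (T.ancestor 0 i u) u v (T.ancestor 0 i v)
  rw [dist_comm _ u] at h₃
  linarith

theorem dist_le_dist_ancestor (u v : X) {i : ℕ} (hi : i ≤ topLevel X) :
    dist u v ≤ dist (T.ancestor 0 i u) (T.ancestor 0 i v) + 5 / 2 * rad i := by
  have h₁ := T.dist_ancestor_le u hi
  have h₂ := T.dist_ancestor_le v hi
  have h₃ := dist_triangle4 u (T.ancestor 0 i u) (T.ancestor 0 i v) v
  rw [dist_comm v] at h₂
  linarith

theorem dist_leaf_le {i : ℕ} (hi : i ≤ topLevel X) {x v : X} (hv : v ∈ T.leaves i x) :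
    dist x v ≤ 5 / 4 * rad i := by
  have := T.dist_ancestor_le v hi
  rw [show T.ancestor 0 i v = x from hv, dist_comm] at this
  exact this

theorem rad_le_dist_of_mem_net (hX : ∀ p q : X, p ≠ q → 64 ≤ dist p q) {i : ℕ}
    (hi : i ≤ topLevel X) {p q : X} (hp : p ∈ T.net i) (hq : q ∈ T.net i) (hpq : p ≠ q) :
    rad i ≤ dist p q := by
  cases i with
  | zero => have := hX p q hpq; simp only [rad, pow_zero]; linarith
  | succ i => exact (T.net_succ i hi).2.1 p hp q hq hpq

theorem leaves_zero (x : X) : T.leaves 0 x = {x} := by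
  ext v; simp [leaves, ancestor]

end NetTree

/-! ### The parameter `λ` -/

variable {ε : ℝ}

theorem le_lam (hε : 0 < ε) (hε' : ε ≤ 1 / 20) : 21 * 5 ^ 20 ≤ lam ε := by
  unfold lam
  have : 20 ≤ 1 / ε := by rw [le_div_iff₀ hε]; linarith
  nlinarith

theorem le_mul_lam (hε : 0 < ε) : 5 ^ 20 ≤ ε * lam ε := by
  unfold lam
  have : ε * (5 ^ 20 * (1 + 1 / ε)) = 5 ^ 20 * ε + 5 ^ 20 := by field_simp
  rw [this]; linarith

theorem lam_le (hε : 0 < ε) (hε' : ε ≤ 1 / 20) : lam ε ≤ 2 * 5 ^ 20 / ε := by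
  unfold lam
  rw [le_div_iff₀ hε]
  have : 5 ^ 20 * (1 + 1 / ε) * ε = 5 ^ 20 * ε + 5 ^ 20 := by field_simp
  rw [this]; linarith

theorem five_rpow_logLam (hε : 0 < ε) (hε' : ε ≤ 1 / 20) : (5 : ℝ) ^ logLam ε = lam ε := by
  have := le_lam hε hε'
  exact Real.rpow_logb (by norm_num) (by norm_num) (by linarith)

theorem le_logLam (hε : 0 < ε) (hε' : ε ≤ 1 / 20) : 20 ≤ logLam ε := by
  have := le_lam hε hε'
  unfold logLam
  rw [Real.le_logb_iff_rpow_le (by norm_num) (by linarith)]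
  norm_num at this ⊢
  linarith

/-- A difference of levels of at least `log λ` makes up for a factor `λ`. -/
theorem lam_mul_rad_le (hε : 0 < ε) (hε' : ε ≤ 1 / 20) {i j : ℕ} (h : logLam ε + i ≤ j) :
    lam ε * rad i ≤ rad j := by
  unfold rad
  rw [← five_rpow_logLam hε hε', ← Real.rpow_natCast, ← Real.rpow_natCast,
    ← Real.rpow_add (by norm_num)]
  exact Real.rpow_le_rpow_of_exponent_le (by norm_num) h

end Tree

/-! ### Degrees and bipartite connections -/

section Connections

variable {X : Type*} {f : ℕ} {H H' Hc : SimpleGraph X} {S₁ S₂ : Set X} {M : Set (Sym2 X)}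

theorem deg_mono [Finite X] (h : H ≤ H') (v : X) : deg H v ≤ deg H' v :=
  Set.ncard_le_ncard (fun _ hw => h hw) (Set.toFinite _)

theorem deg_bot (v : X) : deg (⊥ : SimpleGraph X) v = 0 := by
  simp [deg]

theorem exists_isBipartiteConnection [Finite X] (h₁ : S₁.ncard ≤ f + 1) (h₂ : S₂.ncard ≤ f + 1) :
    ∃ M, IsBipartiteConnection f S₁ S₂ M := by
  rcases lt_or_ge (min S₁.ncard S₂.ncard) (f + 1) with hlt | hge
  · exact ⟨_, fun _ => rfl, fun h => absurd h (not_le.2 hlt)⟩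
  · have e₁ : S₁.ncard = f + 1 := le_antisymm h₁ (hge.trans (min_le_left _ _))
    have e₂ : S₂.ncard = f + 1 := le_antisymm h₂ (hge.trans (min_le_right _ _))
    have hne : Nonempty X := by
      obtain ⟨a, -⟩ := Set.nonempty_of_ncard_ne_zero (s := S₁) (by omega)
      exact ⟨a⟩
    obtain ⟨φ, hφ⟩ := (Set.toFinite S₁).exists_bijOn_of_encard_eq (t := S₂) (by
      rw [← (Set.toFinite S₁).cast_ncard_eq, ← (Set.toFinite S₂).cast_ncard_eq, e₁, e₂])
    exact ⟨_, fun h => absurd h (not_lt.2 hge), fun _ => ⟨φ, hφ, rfl⟩⟩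

theorem IsBipartiteConnection.exists_of_mem (h : IsBipartiteConnection f S₁ S₂ M) {e : Sym2 X}
    (he : e ∈ M) : ∃ u ∈ S₁, ∃ v ∈ S₂, e = s(u, v) := by
  rcases lt_or_ge (min S₁.ncard S₂.ncard) (f + 1) with hlt | hge
  · rw [h.1 hlt] at he; exact he
  · obtain ⟨φ, hφ, rfl⟩ := h.2 hge
    obtain ⟨u, hu, rfl⟩ := he
    exact ⟨u, hu, φ u, hφ.mapsTo hu, rfl⟩

theorem IsBipartiteConnection.mem_of_adj (h : IsBipartiteConnection f S₁ S₂ M) {a b : X}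
    (hab : (SimpleGraph.fromEdgeSet M).Adj a b) : (a ∈ S₁ ∧ b ∈ S₂) ∨ (a ∈ S₂ ∧ b ∈ S₁) := by
  obtain ⟨u, hu, v, hv, huv⟩ := h.exists_of_mem ((SimpleGraph.fromEdgeSet_adj M).1 hab).1
  rcases Sym2.eq_iff.1 huv with ⟨rfl, rfl⟩ | ⟨rfl, rfl⟩
  · exact .inl ⟨hu, hv⟩
  · exact .inr ⟨hv, hu⟩

theorem IsBipartiteConnection.deg_sup_eq (h : IsBipartiteConnection f S₁ S₂ M) {v : X}
    (h₁ : v ∉ S₁) (h₂ : v ∉ S₂) : deg (Hc ⊔ SimpleGraph.fromEdgeSet M) v = deg Hc v := by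
  unfold deg
  congr 1
  ext w
  simp only [SimpleGraph.mem_neighborSet, SimpleGraph.sup_adj]
  refine ⟨fun hw => hw.resolve_right fun hw => ?_, .inl⟩
  rcases h.mem_of_adj hw with ⟨hv, -⟩ | ⟨hv, -⟩
  · exact h₁ hv
  · exact h₂ hv

theorem IsBipartiteConnection.deg_sup_le [Finite X] (h : IsBipartiteConnection f S₁ S₂ M)
    (h₁ : S₁.ncard ≤ f + 1) (h₂ : S₂.ncard ≤ f + 1) (v : X) :
    deg (Hc ⊔ SimpleGraph.fromEdgeSet M) v ≤ deg Hc v + 2 * (f + 1) := by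
  have hsub : (Hc ⊔ SimpleGraph.fromEdgeSet M).neighborSet v ⊆ Hc.neighborSet v ∪ (S₁ ∪ S₂) := by
    intro w hw
    rcases hw with hw | hw
    · exact .inl hw
    · rcases h.mem_of_adj hw with ⟨-, hw⟩ | ⟨-, hw⟩
      · exact .inr (.inr hw)
      · exact .inr (.inl hw)
  have h₃ := Set.ncard_le_ncard hsub (Set.toFinite _)
  have h₄ := Set.ncard_union_le (Hc.neighborSet v) (S₁ ∪ S₂)
  have h₅ := Set.ncard_union_le S₁ S₂
  unfold deg
  omega

end Connections

/-! ### Surrogate sets -/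

section Surrogates

variable {X : Type*} [MetricSpace X] {T : NetTree X} {f i : ℕ} {ε ξ : ℝ}
  {Hᵢ Hc : SimpleGraph X} {x : X} {S : Set X}

theorem IsSurrogateSet.ncard_le (h : IsSurrogateSet T f ε ξ Hᵢ Hc i x S) : S.ncard ≤ f + 1 := by
  by_cases hs : IsSmall T f ε ξ Hᵢ i x
  · rw [(h.1 hs).2]; exact min_le_left _ _
  · rcases le_or_gt (f + 1) (semiSaturated f ε ξ Hᵢ Hc i x).ncard with hle | hlt
    · exact ((h.2 hs).1 hle).2.le
    · obtain ⟨A, -, hA, rfl⟩ := (h.2 hs).2 hlt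
      have h₁ := Set.ncard_union_le (semiSaturated f ε ξ Hᵢ Hc i x) A
      have h₂ : A.ncard ≤ f + 1 - (semiSaturated f ε ξ Hᵢ Hc i x).ncard := by
        rw [hA]; exact min_le_left _ _
      omega

/-- A point of a surrogate set is a leaf of a small node, or semi-saturated, or a clean point that
was chosen because there are at most `f` semi-saturated points. -/
theorem IsSurrogateSet.mem_cases (h : IsSurrogateSet T f ε ξ Hᵢ Hc i x S) {u : X} (hu : u ∈ S) :
    (IsSmall T f ε ξ Hᵢ i x ∧ u ∈ T.leaves i x) ∨ u ∈ semiSaturated f ε ξ Hᵢ Hc i x ∨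
      (u ∈ clean f ε ξ Hc i x ∧ (semiSaturated f ε ξ Hᵢ Hc i x).ncard ≤ f) := by
  by_cases hs : IsSmall T f ε ξ Hᵢ i x
  · exact .inl ⟨hs, (h.1 hs).1 hu⟩
  · right
    rcases le_or_gt (f + 1) (semiSaturated f ε ξ Hᵢ Hc i x).ncard with hle | hlt
    · exact .inl (((h.2 hs).1 hle).1 hu)
    · obtain ⟨A, hAc, -, rfl⟩ := (h.2 hs).2 hlt
      rcases hu with hu | hu
      · exact .inl hu
      · exact .inr ⟨hAc hu, by omega⟩

theorem IsSurrogateSet.dist_le (h : IsSurrogateSet T f ε ξ Hᵢ Hc i x S) (hi : i ≤ topLevel X)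
    {u : X} (hu : u ∈ S) : dist x u ≤ 16 * rad i := by
  have := rad_pos i
  rcases h.mem_cases hu with ⟨-, hu⟩ | hu | ⟨hu, -⟩
  · linarith [T.dist_leaf_le hi hu]
  · exact hu.1
  · linarith [hu.1]

/-- A surrogate set exists, whatever the graphs are. -/
theorem exists_isSurrogateSet [Finite X] (T : NetTree X) (f : ℕ) (ε ξ : ℝ) (Hᵢ Hc : SimpleGraph X)
    (i : ℕ) (x : X) : ∃ S, IsSurrogateSet T f ε ξ Hᵢ Hc i x S := by
  by_cases hs : IsSmall T f ε ξ Hᵢ i x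
  · obtain ⟨S, hS, hcard⟩ := Set.exists_subset_card_eq
      (min_le_right (f + 1) (T.leaves i x).ncard)
    exact ⟨S, fun _ => ⟨hS, hcard⟩, fun h => absurd hs h⟩
  · rcases le_or_gt (f + 1) (semiSaturated f ε ξ Hᵢ Hc i x).ncard with hle | hlt
    · obtain ⟨S, hS, hcard⟩ := Set.exists_subset_card_eq hle
      exact ⟨S, fun h => absurd h hs, fun _ => ⟨fun _ => ⟨hS, hcard⟩,
        fun h => absurd h (not_lt.2 hle)⟩⟩
    · obtain ⟨A, hA, hcard⟩ := Set.exists_subset_card_eq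
        (min_le_right (f + 1 - (semiSaturated f ε ξ Hᵢ Hc i x).ncard)
          (clean f ε ξ Hc i x).ncard)
      exact ⟨semiSaturated f ε ξ Hᵢ Hc i x ∪ A, fun h => absurd h hs,
        fun _ => ⟨fun h => absurd h (not_le.2 hlt), fun _ => ⟨A, hA, hcard, rfl⟩⟩⟩

end Surrogates

/-! ### Processing the edges of one level -/

section ProcessEdges

variable {X : Type*} [MetricSpace X] {T : NetTree X} {f i : ℕ} {ε ξ : ℝ}
  {Hᵢ Hc H' : SimpleGraph X} {l : List (X × X)}

theorem exists_processEdges [Finite X] (T : NetTree X) (f : ℕ) (ε ξ : ℝ) (Hᵢ : SimpleGraph X)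
    (i : ℕ) (l : List (X × X)) : ∀ Hc, ∃ H', ProcessEdges T f ε ξ Hᵢ i Hc l H' := by
  induction l with
  | nil => exact fun Hc => ⟨Hc, .nil Hc⟩
  | cons q l ih =>
    intro Hc
    obtain ⟨S₁, h₁⟩ := exists_isSurrogateSet T f ε ξ Hᵢ Hc i q.1
    obtain ⟨S₂, h₂⟩ := exists_isSurrogateSet T f ε ξ Hᵢ Hc i q.2
    obtain ⟨M, hM⟩ := exists_isBipartiteConnection h₁.ncard_le h₂.ncard_le
    obtain ⟨H', hH'⟩ := ih (Hc ⊔ SimpleGraph.fromEdgeSet M)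
    exact ⟨H', .cons Hc H' q.1 q.2 l S₁ S₂ M h₁ h₂ hM hH'⟩

theorem ProcessEdges.le (h : ProcessEdges T f ε ξ Hᵢ i Hc l H') : Hc ≤ H' := by
  induction h with
  | nil => exact le_rfl
  | cons _ _ _ _ _ _ _ _ _ _ _ _ ih => exact le_sup_left.trans ih

theorem ProcessEdges.exists_of_mem (h : ProcessEdges T f ε ξ Hᵢ i Hc l H') {q : X × X}
    (hq : q ∈ l) : ∃ Hd S₁ S₂ M, IsSurrogateSet T f ε ξ Hᵢ Hd i q.1 S₁ ∧
      IsSurrogateSet T f ε ξ Hᵢ Hd i q.2 S₂ ∧ IsBipartiteConnection f S₁ S₂ M ∧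
      SimpleGraph.fromEdgeSet M ≤ H' := by
  induction h with
  | nil => simp at hq
  | cons Hc H' x y l S₁ S₂ M h₁ h₂ hM h ih =>
    rcases List.mem_cons.1 hq with rfl | hq
    · exact ⟨Hc, S₁, S₂, M, h₁, h₂, hM, le_sup_right.trans h.le⟩
    · exact ih hq

theorem ProcessEdges.exists_of_adj (h : ProcessEdges T f ε ξ Hᵢ i Hc l H') {a b : X}
    (hab : H'.Adj a b) (hab' : ¬ Hc.Adj a b) : ∃ q ∈ l, ∃ Hd S₁ S₂,
      IsSurrogateSet T f ε ξ Hᵢ Hd i q.1 S₁ ∧ IsSurrogateSet T f ε ξ Hᵢ Hd i q.2 S₂ ∧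
      ((a ∈ S₁ ∧ b ∈ S₂) ∨ (a ∈ S₂ ∧ b ∈ S₁)) := by
  induction h with
  | nil => exact absurd hab hab'
  | cons Hc H' x y l S₁ S₂ M h₁ h₂ hM h ih =>
    by_cases hM' : (SimpleGraph.fromEdgeSet M).Adj a b
    · exact ⟨(x, y), by simp, Hc, S₁, S₂, h₁, h₂, hM.mem_of_adj hM'⟩
    · obtain ⟨q, hq, h⟩ := ih hab (fun h => h.elim hab' hM')
      exact ⟨q, by simp [hq], h⟩

open Classical in
/-- The degree of `v` grows by at most `2 (f + 1)` with every edge that has an endpoint near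
`v`, and does not change otherwise. -/
theorem ProcessEdges.deg_le [Finite X] (hi : i ≤ topLevel X)
    (h : ProcessEdges T f ε ξ Hᵢ i Hc l H') (v : X) :
    deg H' v ≤ deg Hc v +
      2 * (f + 1) * l.countP (fun q => dist v q.1 ≤ 16 * rad i ∨ dist v q.2 ≤ 16 * rad i) := by
  induction h with
  | nil => simp
  | cons Hc H' x y l S₁ S₂ M h₁ h₂ hM h ih =>
    rw [List.countP_cons]
    by_cases hv : v ∈ S₁ ∨ v ∈ S₂
    · have hnear : dist v x ≤ 16 * rad i ∨ dist v y ≤ 16 * rad i := by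
        rw [dist_comm v x, dist_comm v y]
        exact hv.imp (h₁.dist_le hi) (h₂.dist_le hi)
      have := hM.deg_sup_le (Hc := Hc) h₁.ncard_le h₂.ncard_le v
      rw [if_pos (decide_eq_true hnear), mul_add _ _ 1]
      linarith
    · rw [not_or] at hv
      rw [hM.deg_sup_eq hv.1 hv.2] at ih
      refine ih.trans ?_
      gcongr
      exact Nat.le_add_right _ _

/-- If the degree of a point of `B(p, 6rᵢ)` passes the threshold `c₂ f`, then afterwards this ball
contains few unsaturated points beyond the threshold: at the last such event there were at most `f`
of them, and at most `2 (f + 1)` points were chosen. -/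
theorem ProcessEdges.ncard_le_of_promoted [Finite X] (h : ProcessEdges T f ε ξ Hᵢ i Hc l H')
    (hle : Hᵢ ≤ Hc) (hsmall : ∀ u, (deg Hᵢ u : ℝ) ≤ c₁ ε ξ * f → (deg H' u : ℝ) < c₂ ε ξ * f)
    {p w : X} (hw : dist p w ≤ 6 * rad i) (hw₁ : (deg Hc w : ℝ) < c₂ ε ξ * f)
    (hw₂ : c₂ ε ξ * f ≤ deg H' w) :
    {u | dist p u ≤ 6 * rad i ∧ ¬ IsSaturated f ε ξ Hᵢ u ∧ c₂ ε ξ * f ≤ deg H' u}.ncard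
      ≤ 3 * f + 2 := by
  induction h generalizing w with
  | nil => exact absurd hw₂ (not_le.2 hw₁)
  | cons Hc H' x y l S₁ S₂ M h₁ h₂ hM h ih =>
    by_cases hlater : ∃ w', dist p w' ≤ 6 * rad i ∧
        (deg (Hc ⊔ SimpleGraph.fromEdgeSet M) w' : ℝ) < c₂ ε ξ * f ∧ c₂ ε ξ * f ≤ deg H' w'
    · obtain ⟨w', hpw', hw'₁, hw'₂⟩ := hlater
      exact ih (hle.trans le_sup_left) hsmall hpw' hw'₁ hw'₂
    · push Not at hlater
      have hsurr : ∃ z S, IsSurrogateSet T f ε ξ Hᵢ Hc i z S ∧ w ∈ S := by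
        by_contra hno
        push Not at hno
        have hlt := hlater w hw (by rwa [hM.deg_sup_eq (hno x S₁ h₁) (hno y S₂ h₂)])
        exact absurd hw₂ (not_le.2 hlt)
      obtain ⟨z, S, hS, hwS⟩ := hsurr
      have hclean : w ∈ clean f ε ξ Hc i z ∧ (semiSaturated f ε ξ Hᵢ Hc i z).ncard ≤ f := by
        rcases hS.mem_cases hwS with ⟨hs, hwl⟩ | hwm | hwc
        · exact absurd hw₂ (not_le.2 (hsmall w (hs w hwl)))
        · exact absurd hwm.2.1 (not_le.2 hw₁)
        · exact hwc
      have hsub : {u | dist p u ≤ 6 * rad i ∧ ¬ IsSaturated f ε ξ Hᵢ u ∧ c₂ ε ξ * f ≤ deg H' u} ⊆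
          semiSaturated f ε ξ Hᵢ Hc i z ∪ (S₁ ∪ S₂) := by
        rintro u ⟨hu, hus, hud⟩
        by_cases huS : u ∈ S₁ ∪ S₂
        · exact .inr huS
        · rw [Set.mem_union, not_or] at huS
          refine .inl ⟨?_, ?_, hus⟩
          · have hr := rad_pos i
            have h₃ := dist_triangle4 z w p u
            rw [dist_comm w p] at h₃
            linarith [hclean.1.1]
          · by_contra hlt
            have := hlater u hu (by rw [hM.deg_sup_eq huS.1 huS.2]; exact not_le.1 hlt)
            exact absurd hud (not_le.2 this)
      have h₃ := Set.ncard_le_ncard hsub (Set.toFinite _)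
      have h₄ := Set.ncard_union_le (semiSaturated f ε ξ Hᵢ Hc i z) (S₁ ∪ S₂)
      have h₅ := Set.ncard_union_le S₁ S₂
      have h₆ := h₁.ncard_le
      have h₇ := h₂.ncard_le
      have h₈ := hclean.2
      omega

end ProcessEdges

/-! ### Runs of the construction -/

/-- An edge of `Hs k` that is not in `Hs m` is new in one of the iterations `m, …, k - 1`. -/
theorem exists_new_adj {X : Type*} {Hs : ℕ → SimpleGraph X} {m k : ℕ} {a b : X}
    (hab : (Hs k).Adj a b) (hab' : ¬ (Hs m).Adj a b)
    (hmk : m ≤ k) : ∃ j, m ≤ j ∧ j < k ∧ (Hs (j + 1)).Adj a b ∧ ¬ (Hs j).Adj a b := by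
  induction k, hmk using Nat.le_induction with
  | base => exact absurd hab hab'
  | succ k hmk ih =>
    by_cases h : (Hs k).Adj a b
    · obtain ⟨j, h₁, h₂, h₃⟩ := ih h
      exact ⟨j, h₁, by omega, h₃⟩
    · exact ⟨k, hmk, k.lt_succ_self, hab, h⟩

section Runs

variable {X : Type*} [MetricSpace X] {T : NetTree X} {G : SimpleGraph X} {f : ℕ} {d ε ξ : ℝ}
  {Hs Hs' : ℕ → SimpleGraph X}

/-- Iteration `i` turns `Hs i` into `Hs (i + 1)`. -/
def IsStep (T : NetTree X) (G : SimpleGraph X) (f : ℕ) (ε ξ : ℝ) (Hs : ℕ → SimpleGraph X)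
    (i : ℕ) : Prop :=
  ∃ l : List (X × X), (l.map fun p => s(p.1, p.2)).Nodup ∧
    (∀ e : Sym2 X, e ∈ (l.map fun p => s(p.1, p.2)) ↔ e ∈ EStar T G f ε ξ Hs i) ∧
    ProcessEdges T f ε ξ (Hs i) i (Hs i) l (Hs (i + 1))

/-- `Hs` is the sequence of graphs at the beginnings of the iterations of a run of the
construction. -/
def IsRun (T : NetTree X) (G : SimpleGraph X) (f : ℕ) (ε ξ : ℝ) (Hs : ℕ → SimpleGraph X) : Prop :=
  Hs 0 = ⊥ ∧ ∀ i < topLevel X, IsStep T G f ε ξ Hs i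

theorem phaseTwoEdges_mono_of_eq {i : ℕ} (h : ∀ j ≤ i, Hs j = Hs' j) :
    phaseTwoEdges T f ε ξ Hs i ⊆ phaseTwoEdges T f ε ξ Hs' i := by
  rintro e ⟨x, hx, ⟨j, hj, hj', w, hw, hwx, hs, hcard⟩, he⟩
  exact ⟨x, hx, ⟨j, hj, hj', w, hw, hwx, h j hj ▸ hs, hcard⟩, he⟩

theorem EStar_congr {i : ℕ} (h : ∀ j ≤ i, Hs j = Hs' j) :
    EStar T G f ε ξ Hs i = EStar T G f ε ξ Hs' i := by
  unfold EStar
  rw [(phaseTwoEdges_mono_of_eq h).antisymm (phaseTwoEdges_mono_of_eq fun j hj => (h j hj).symm)]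

theorem IsStep.congr {i : ℕ} (h : ∀ j ≤ i + 1, Hs j = Hs' j) (hs : IsStep T G f ε ξ Hs i) :
    IsStep T G f ε ξ Hs' i := by
  obtain ⟨l, hl, hmem, hp⟩ := hs
  rw [EStar_congr fun j hj => h j (hj.trans i.le_succ)] at hmem
  rw [h i i.le_succ, h (i + 1) le_rfl] at hp
  exact ⟨l, hl, hmem, hp⟩

theorem exists_isRun [Finite X] (T : NetTree X) (G : SimpleGraph X) (f : ℕ) (ε ξ : ℝ) :
    ∃ Hs, IsRun T G f ε ξ Hs := by
  suffices h : ∀ n, ∃ Hs : ℕ → SimpleGraph X, Hs 0 = ⊥ ∧ ∀ i < n, IsStep T G f ε ξ Hs i from h _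
  intro n
  induction n with
  | zero => exact ⟨fun _ => ⊥, rfl, by simp⟩
  | succ n ih =>
    obtain ⟨Hs, h₀, hstep⟩ := ih
    set E := (Set.toFinite (EStar T G f ε ξ Hs n)).toFinset
    have hmap : ((E.toList.map Quot.out).map fun p : X × X => s(p.1, p.2)) = E.toList := by
      rw [List.map_map]
      conv_rhs => rw [← List.map_id E.toList]
      exact List.map_congr_left fun e _ => Quot.out_eq e
    obtain ⟨H', hH'⟩ := exists_processEdges T f ε ξ (Hs n) n (E.toList.map Quot.out) (Hs n)
    have hne : ∀ j ≤ n, Hs j = Function.update Hs (n + 1) H' j := fun j hj => by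
      rw [Function.update_of_ne (by omega)]
    refine ⟨Function.update Hs (n + 1) H', by rw [← hne 0 (by omega), h₀], fun i hi => ?_⟩
    rcases (Nat.lt_succ_iff.1 hi).lt_or_eq with hlt | rfl
    · exact (hstep i hlt).congr fun j hj => hne j (by omega)
    · refine ⟨E.toList.map Quot.out, ?_, fun e => ?_, ?_⟩
      · rw [hmap]; exact E.nodup_toList
      · rw [hmap, ← EStar_congr hne]; simp [E]
      · rw [Function.update_self, ← hne i le_rfl]; exact hH'

/-- The standing assumptions.  That `d ≥ 1` is a consequence of the first one if there are two
points; `4096 λ` comes from the packing bounds for the cross edges that affect one point. -/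
structure Admissible (X : Type*) [MetricSpace X] (d ε ξ : ℝ) (f : ℕ) : Prop where
  doubling : DoublingDimLE X d
  sep : ∀ p q : X, p ≠ q → 64 ≤ dist p q
  eps_pos : 0 < ε
  eps_le : ε ≤ 1 / 20
  one_le_f : 1 ≤ f
  one_le_d : 1 ≤ d
  le_xi : (4096 * lam ε) ^ d ≤ ξ

namespace Admissible

variable (hA : Admissible X d ε ξ f)

include hA

theorem lam_ge : 21 * 5 ^ 20 ≤ lam ε := le_lam hA.eps_pos hA.eps_le

theorem logLam_ge : 20 ≤ logLam ε := le_logLam hA.eps_pos hA.eps_le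

theorem one_le_xi : 1 ≤ ξ :=
  (Real.one_le_rpow (by linarith [hA.lam_ge]) (by linarith [hA.one_le_d])).trans hA.le_xi

theorem f_le_xi_mul : (f : ℝ) ≤ ξ * f := le_mul_of_one_le_left (Nat.cast_nonneg f) hA.one_le_xi

theorem one_le_xi_mul : 1 ≤ ξ * f :=
  le_trans (by exact_mod_cast hA.one_le_f) hA.f_le_xi_mul

/-- The thresholds are at least `20 ξ f` apart, so a degree cannot pass from one of them to the
next in a single iteration. -/
theorem c₁_add_le : c₁ ε ξ * f + 20 * (ξ * f) ≤ c₂ ε ξ * f := by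
  have := hA.logLam_ge
  have := hA.one_le_xi_mul
  unfold c₁ c₂
  nlinarith

theorem c₂_le_c₃ : c₂ ε ξ * f ≤ c₃ ε ξ * f := by
  have := hA.logLam_ge
  have := hA.one_le_xi_mul
  unfold c₂ c₃
  nlinarith

theorem c₁_nonneg : 0 ≤ c₁ ε ξ * f := by
  have := hA.logLam_ge
  have := hA.one_le_xi_mul
  unfold c₁
  nlinarith

end Admissible

theorem exists_of_mem_EStar (hA : Admissible X d ε ξ f) {i : ℕ} (hi : i ≤ topLevel X) {e : Sym2 X}
    (he : e ∈ EStar T G f ε ξ Hs i) : ∃ x ∈ T.net i, ∃ y ∈ T.net i, e = s(x, y) ∧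
      dist x y ≤ lam ε * rad i ∧ (1 ≤ i → 64 * rad i ≤ dist x y) := by
  rcases he with ⟨u, v, j, -, ⟨hj, hle, hlt⟩, ⟨rfl, rfl⟩ | ⟨-, -, -, haug, hlen⟩⟩ |
    ⟨x, -, -, y, hy, z, hz, h₁, h₂, rfl⟩
  · refine ⟨_, T.ancestor_mem u hi, _, T.ancestor_mem v hi, rfl, hle, fun hi1 => ?_⟩
    obtain ⟨k, rfl⟩ : ∃ k, i = k + 1 := ⟨i - 1, by omega⟩
    have h₁ := hlt k (by omega)
    have h₂ := T.dist_ancestor_ancestor_le u v (i := k) (by omega)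
    have h₃ := T.dist_le_dist_ancestor u v hi
    rw [rad_succ] at h₃ ⊢
    nlinarith [hA.lam_ge, rad_pos k]
  · have hcross : ∃ A, e ∈ T.crossEdges ε i A := by
      rcases haug with h | h <;> exact ⟨_, h⟩
    obtain ⟨A, y, -, z, -, hy, hz, hle, rfl⟩ := hcross
    obtain ⟨y', z', he, hlen⟩ := hlen
    refine ⟨y, hy, z, hz, rfl, hle, fun _ => ?_⟩
    rcases Sym2.eq_iff.1 he with ⟨rfl, rfl⟩ | ⟨rfl, rfl⟩
    · exact hlen
    · rwa [dist_comm]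
  · exact ⟨y, hy.1, z, hz.1, rfl, h₂, fun _ => h₁⟩

theorem mem_net_of_mem_EStar (hA : Admissible X d ε ξ f) {i : ℕ} (hi : i ≤ topLevel X) {x y : X}
    (he : s(x, y) ∈ EStar T G f ε ξ Hs i) : x ∈ T.net i ∧ y ∈ T.net i ∧
      dist x y ≤ lam ε * rad i ∧ (1 ≤ i → 64 * rad i ≤ dist x y) := by
  obtain ⟨a, ha, b, hb, he, h₁, h₂⟩ := exists_of_mem_EStar hA hi he
  rcases Sym2.eq_iff.1 he with ⟨rfl, rfl⟩ | ⟨rfl, rfl⟩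
  · exact ⟨ha, hb, h₁, h₂⟩
  · rw [dist_comm y x] at h₁ h₂
    exact ⟨hb, ha, h₁, h₂⟩

namespace IsRun

variable (hR : IsRun T G f ε ξ Hs)

include hR

theorem step_le {i : ℕ} (hi : i < topLevel X) : Hs i ≤ Hs (i + 1) := by
  obtain ⟨l, -, -, h⟩ := hR.2 i hi
  exact h.le

theorem mono {i j : ℕ} (hij : i ≤ j) (hj : j ≤ topLevel X) : Hs i ≤ Hs j := by
  induction j, hij using Nat.le_induction with
  | base => exact le_rfl
  | succ j hij ih => exact (ih (by omega)).trans (hR.step_le hj)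

theorem deg_mono [Finite X] {i j : ℕ} (hij : i ≤ j) (hj : j ≤ topLevel X) (v : X) :
    (deg (Hs i) v : ℝ) ≤ deg (Hs j) v := by
  exact_mod_cast FTSpanner.deg_mono (hR.mono hij hj) v

open Classical in
/-- By packing, one iteration increases each degree by at most `ξ f`. -/
theorem deg_succ_le [Finite X] (hA : Admissible X d ε ξ f) {i : ℕ} (hi : i < topLevel X) (v : X) :
    (deg (Hs (i + 1)) v : ℝ) ≤ deg (Hs i) v + ξ * f := by
  obtain ⟨l, hl, hmem, h⟩ := hR.2 i hi
  have hr := rad_pos i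
  have hlam := hA.lam_ge
  have hd := hA.one_le_d
  have hdeg := h.deg_le hi.le v
  set near : X × X → Prop := fun q => dist v q.1 ≤ 16 * rad i ∨ dist v q.2 ≤ 16 * rad i
  set A := {x | x ∈ T.net i ∧ dist v x ≤ 16 * rad i}
  set B := {x | x ∈ T.net i ∧ dist v x ≤ (lam ε + 16) * rad i}
  have hnet : ∀ q ∈ l, q.1 ∈ T.net i ∧ q.2 ∈ T.net i ∧ dist q.1 q.2 ≤ lam ε * rad i := by
    intro q hq
    have := mem_net_of_mem_EStar hA hi.le ((hmem s(q.1, q.2)).1 (List.mem_map.2 ⟨q, hq, rfl⟩))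
    exact ⟨this.1, this.2.1, this.2.2.1⟩
  have hcount : l.countP near ≤ 2 * (A.ncard * B.ncard) := by
    have hnd : (l.filter near).Nodup := hl.of_map.filter _
    rw [List.countP_eq_length_filter, ← List.toFinset_card_of_nodup hnd, ← Set.ncard_coe_finset]
    have hsub : ((l.filter near).toFinset : Set (X × X)) ⊆ A ×ˢ B ∪ B ×ˢ A := by
      intro q hq
      simp only [List.coe_toFinset, List.mem_filter, Set.mem_ofPred_eq, decide_eq_true_eq] at hq
      obtain ⟨h₁, h₂, h₃⟩ := hnet q hq.1
      rcases hq.2 with h₄ | h₄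
      · exact .inl ⟨⟨h₁, h₄⟩, h₂, by linarith [dist_triangle v q.1 q.2]⟩
      · rw [dist_comm] at h₃
        exact .inr ⟨⟨h₁, by linarith [dist_triangle v q.2 q.1]⟩, h₂, h₄⟩
    have h₁ := Set.ncard_le_ncard hsub (Set.toFinite _)
    have h₂ := Set.ncard_union_le (A ×ˢ B) (B ×ˢ A)
    rw [Set.ncard_prod, Set.ncard_prod, mul_comm B.ncard] at h₂
    omega
  have hsep : ∀ x ∈ T.net i, ∀ y ∈ T.net i, x ≠ y → rad i ≤ dist x y := fun x hx y hy hxy =>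
    T.rad_le_dist_of_mem_net hA.sep hi.le hx hy hxy
  have hcA : (A.ncard : ℝ) ≤ 64 ^ d := by
    refine (hA.doubling.ncard_le_of_separated (by linarith) hr (R := 16 * rad i) (p := v)
      (by linarith) (fun x hx => hx.2) fun x hx y hy => hsep x hx.1 y hy.1).trans_eq ?_
    congr 1
    field_simp
    norm_num
  have hcB : (B.ncard : ℝ) ≤ (8 * lam ε) ^ d := by
    refine (hA.doubling.ncard_le_of_separated (by linarith) hr (R := (lam ε + 16) * rad i) (p := v)
      (by nlinarith) (fun x hx => hx.2) fun x hx y hy => hsep x hx.1 y hy.1).trans ?_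
    refine Real.rpow_le_rpow (by positivity) ?_ (by linarith)
    rw [← mul_assoc, mul_div_cancel_right₀ _ hr.ne']
    linarith
  have h8 : (8 : ℝ) ≤ 8 ^ d := by
    simpa using Real.rpow_le_rpow_of_exponent_le (x := 8) (by norm_num) hd
  have hprod : (8 : ℝ) ^ d * (64 ^ d * (8 * lam ε) ^ d) = (4096 * lam ε) ^ d := by
    rw [← Real.mul_rpow (by norm_num) (by linarith), ← Real.mul_rpow (by norm_num) (by linarith)]
    congr 1
    ring
  have hf : (1 : ℝ) ≤ f := by exact_mod_cast hA.one_le_f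
  have hdeg' : (deg (Hs (i + 1)) v : ℝ) ≤ deg (Hs i) v + 2 * (f + 1) * (l.countP near : ℕ) := by
    exact_mod_cast hdeg
  have hcount' : ((l.countP near : ℕ) : ℝ) ≤ 2 * (64 ^ d * (8 * lam ε) ^ d) := by
    calc ((l.countP near : ℕ) : ℝ) ≤ 2 * (A.ncard * B.ncard) := by exact_mod_cast hcount
      _ ≤ _ := by gcongr
  refine hdeg'.trans (add_le_add_right ?_ _)
  have hP : 0 ≤ (64 : ℝ) ^ d * (8 * lam ε) ^ d := by positivity
  calc (2 * (f + 1) * (l.countP near : ℕ) : ℝ)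
      ≤ 4 * f * (2 * (64 ^ d * (8 * lam ε) ^ d)) :=
        mul_le_mul (by linarith) hcount' (by positivity) (by positivity)
    _ = f * (8 * (64 ^ d * (8 * lam ε) ^ d)) := by ring
    _ ≤ f * (8 ^ d * (64 ^ d * (8 * lam ε) ^ d)) := by gcongr
    _ ≤ f * ξ := by rw [hprod]; gcongr; exact hA.le_xi
    _ = ξ * f := mul_comm _ _

theorem deg_le_add [Finite X] (hA : Admissible X d ε ξ f) {i j : ℕ} (hij : i ≤ j)
    (hj : j ≤ topLevel X) (v : X) :
    (deg (Hs j) v : ℝ) ≤ deg (Hs i) v + (j - i) * (ξ * f) := by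
  induction j, hij using Nat.le_induction with
  | base => simp
  | succ j hij ih =>
    have h₁ := ih (by omega)
    have h₂ := hR.deg_succ_le hA hj v
    push_cast
    linarith

/-- The edges that are new in iteration `j` are about as long as the cross edges of level `j`. -/
theorem dist_of_new_adj [Finite X] (hA : Admissible X d ε ξ f) {j : ℕ} (hj : j < topLevel X)
    {a b : X} (hab : (Hs (j + 1)).Adj a b) (hab' : ¬ (Hs j).Adj a b) :
    dist a b ≤ (lam ε + 32) * rad j ∧ (1 ≤ j → 32 * rad j ≤ dist a b) := by
  obtain ⟨l, -, hmem, h⟩ := hR.2 j hj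
  obtain ⟨q, hq, Hd, S₁, S₂, h₁, h₂, hS⟩ := h.exists_of_adj hab hab'
  obtain ⟨-, -, h₃, h₄⟩ :=
    mem_net_of_mem_EStar hA hj.le ((hmem s(q.1, q.2)).1 (List.mem_map.2 ⟨q, hq, rfl⟩))
  rcases hS with ⟨ha, hb⟩ | ⟨ha, hb⟩
  · have h₅ := h₁.dist_le hj.le ha
    have h₆ := h₂.dist_le hj.le hb
    have h₇ := dist_triangle4 a q.1 q.2 b
    have h₈ := dist_triangle4 q.1 a b q.2
    rw [dist_comm a q.1] at h₇
    rw [dist_comm b q.2] at h₈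
    exact ⟨by linarith, fun hj1 => by linarith [h₄ hj1]⟩
  · have h₅ := h₂.dist_le hj.le ha
    have h₆ := h₁.dist_le hj.le hb
    have h₇ := dist_triangle4 a q.2 q.1 b
    have h₈ := dist_triangle4 q.2 a b q.1
    rw [dist_comm a q.2, dist_comm q.2 q.1] at h₇
    rw [dist_comm b q.1, dist_comm q.2 q.1] at h₈
    exact ⟨by linarith, fun hj1 => by linarith [h₄ hj1]⟩

theorem ncard_le_of_promoted [Finite X] (hA : Admissible X d ε ξ f) {k : ℕ} (hk : k < topLevel X)
    {w : X} (hw₁ : (deg (Hs k) w : ℝ) < c₂ ε ξ * f) (hw₂ : c₂ ε ξ * f ≤ deg (Hs (k + 1)) w) :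
    {u | dist w u ≤ 6 * rad k ∧ ¬ IsSaturated f ε ξ (Hs k) u ∧
      c₂ ε ξ * f ≤ deg (Hs (k + 1)) u}.ncard ≤ 3 * f + 2 := by
  obtain ⟨l, -, -, h⟩ := hR.2 k hk
  refine h.ncard_le_of_promoted le_rfl (fun u hu => ?_)
    (by rw [dist_self]; linarith [rad_pos k]) hw₁ hw₂
  linarith [hR.deg_succ_le hA hk u, hA.c₁_add_le, hA.one_le_xi_mul]

end IsRun

end Runs

/-! ### Abundance of clean points -/

/-- The iteration in which the degree of `z` passes the threshold `c₂ f`. -/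
theorem exists_promotion {X : Type*} {Hs : ℕ → SimpleGraph X} {f : ℕ} {ε ξ : ℝ} {j k : ℕ}
    (hjk : j ≤ k) {z : X}
    (h₁ : (deg (Hs j) z : ℝ) < c₂ ε ξ * f) (h₂ : c₂ ε ξ * f ≤ deg (Hs k) z) :
    ∃ m, j ≤ m ∧ m < k ∧
      (deg (Hs m) z : ℝ) < c₂ ε ξ * f ∧ c₂ ε ξ * f ≤ deg (Hs (m + 1)) z := by
  induction k, hjk using Nat.le_induction with
  | base => exact absurd h₂ (not_le.2 h₁)
  | succ k hjk ih =>
    by_cases h : c₂ ε ξ * f ≤ deg (Hs k) z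
    · obtain ⟨m, h₁, h₂, h₃⟩ := ih h
      exact ⟨m, h₁, by omega, h₃⟩
    · exact ⟨k, hjk, k.lt_succ_self, not_le.1 h, h₂⟩

section Abundance

variable {X : Type*} [MetricSpace X] {T : NetTree X} {G : SimpleGraph X} {f : ℕ} {d ε ξ : ℝ}
  {Hs : ℕ → SimpleGraph X}

/-- The points of `B(p, r)` of degree less than `c₂ f`. -/
def cleanBall (f : ℕ) (ε ξ : ℝ) (H : SimpleGraph X) (p : X) (r : ℝ) : Set X :=
  {u | dist p u ≤ r ∧ (deg H u : ℝ) < c₂ ε ξ * f}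

/-- Every point of degree more than `c₁ f` has many clean points within distance `2rᵢ`. -/
def CleanAbundant (f : ℕ) (ε ξ : ℝ) (H : SimpleGraph X) (i : ℕ) : Prop :=
  ∀ v, c₁ ε ξ * f < deg H v → 3 * f + 2 ≤ (cleanBall f ε ξ H v (2 * rad i)).ncard

/-- A number of levels over which the radius grows by a factor of at least `25 λ`. -/
noncomputable def levelGap (ε : ℝ) : ℕ := ⌈logLam ε⌉₊ + 2

theorem Admissible.levelGap_le (hA : Admissible X d ε ξ f) : (levelGap ε : ℝ) ≤ logLam ε + 3 := by
  have := Nat.ceil_lt_add_one (show 0 ≤ logLam ε by linarith [hA.logLam_ge])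
  unfold levelGap
  push_cast
  linarith

theorem Admissible.lam_mul_rad_le (hA : Admissible X d ε ξ f) {j k : ℕ}
    (h : logLam ε + 3 + j ≤ k) : 125 * (lam ε * rad j) ≤ rad k := by
  have := FTSpanner.lam_mul_rad_le hA.eps_pos hA.eps_le (i := j + 3) (j := k)
    (by push_cast; linarith)
  rw [rad_add] at this
  linarith

theorem Admissible.lam_mul_rad_le_of_lt (hA : Admissible X d ε ξ f) {j k : ℕ}
    (h : j < k - levelGap ε) : 125 * (lam ε * rad j) ≤ rad k := by
  refine hA.lam_mul_rad_le ?_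
  have h₁ : j + 1 + levelGap ε ≤ k := by omega
  have h₂ : ((j + 1 + levelGap ε : ℕ) : ℝ) ≤ k := by exact_mod_cast h₁
  have h₃ := Nat.le_ceil (logLam ε)
  unfold levelGap at h₂
  push_cast at h₂
  linarith

namespace IsRun

variable (hR : IsRun T G f ε ξ Hs)

include hR

theorem dist_le_of_adj [Finite X] (hA : Admissible X d ε ξ f) {k : ℕ} (hk : k ≤ topLevel X)
    {w u : X} (h : (Hs (k - levelGap ε)).Adj w u) : dist w u ≤ rad k / 10 := by
  obtain ⟨j, -, hj, h₁, h₂⟩ := exists_new_adj h (m := 0) (by simp [hR.1]) (Nat.zero_le _)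
  have h₃ := (hR.dist_of_new_adj hA (by omega) h₁ h₂).1
  have h₄ := hA.lam_mul_rad_le_of_lt hj
  nlinarith [rad_pos j, hA.lam_ge]

theorem deg_le_deg_sub [Finite X] (hA : Admissible X d ε ξ f) {k : ℕ} (hk : k ≤ topLevel X)
    (w : X) : (deg (Hs k) w : ℝ) ≤ deg (Hs (k - levelGap ε)) w + (logLam ε + 3) * (ξ * f) := by
  have h₁ := hR.deg_le_add hA (Nat.sub_le k (levelGap ε)) hk w
  have h₂ : (k : ℝ) ≤ ((k - levelGap ε : ℕ) : ℝ) + levelGap ε := by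
    exact_mod_cast (by omega : k ≤ k - levelGap ε + levelGap ε)
  have h₃ := hA.levelGap_le
  have h₄ := hA.one_le_xi_mul
  refine h₁.trans (add_le_add_right ?_ _)
  gcongr
  linarith

/-- A point whose degree passes the threshold `c₂ f` in iteration `k` has many clean points around
it, also at the end of the iteration.  Otherwise nearly all points near `w` are saturated.  Among
these consider the last point `z` to pass the threshold, in iteration `m` say.  Since then `z` has
acquired many neighbours, so one of them is saturated as well; both it and `z` were past the
threshold when they became adjacent, in an iteration `j > m`.  At that time there were two disjoint
balls with many clean points around them, and some of these points are saturated by now, so they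
passed the threshold later than `z`. -/
theorem le_ncard_cleanBall_of_promoted [Finite X] (hA : Admissible X d ε ξ f) {k : ℕ}
    (hk : k < topLevel X) (hP : ∀ j ≤ k, CleanAbundant f ε ξ (Hs j) j) {w : X}
    (hw₁ : (deg (Hs k) w : ℝ) < c₂ ε ξ * f) (hw₂ : c₂ ε ξ * f ≤ deg (Hs (k + 1)) w) :
    3 * f + 2 ≤ (cleanBall f ε ξ (Hs (k + 1)) w (2 * rad k)).ncard := by
  by_contra! hfew
  have hrk := rad_pos k
  have hlam := hA.lam_ge
  have hL := hA.logLam_ge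
  have hD := hA.one_le_xi_mul
  have hfD := hA.f_le_xi_mul
  have h12 := hA.c₁_add_le
  have hc₂ : c₂ ε ξ * f = 51 * (logLam ε * (ξ * f)) := by unfold c₂; ring
  have hc₃ : c₃ ε ξ * f = 55 * (logLam ε * (ξ * f)) := by unfold c₃; ring
  have hLD : 20 * (ξ * f) ≤ logLam ε * (ξ * f) := by gcongr
  have hsat : ∀ Y : Set X, (∀ y ∈ Y, dist w y ≤ 2 * rad k) → 2 * (3 * f + 2) ≤ Y.ncard →
      ∃ y ∈ Y, c₃ ε ξ * f < deg (Hs k) y := by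
    intro Y hY hcard
    by_contra! hno
    have hZ := hR.ncard_le_of_promoted hA hk hw₁ hw₂
    have hsub : Y ⊆ cleanBall f ε ξ (Hs (k + 1)) w (2 * rad k) ∪
        {u | dist w u ≤ 6 * rad k ∧ ¬ IsSaturated f ε ξ (Hs k) u ∧
          c₂ ε ξ * f ≤ deg (Hs (k + 1)) u} := by
      intro y hy
      rcases lt_or_ge (deg (Hs (k + 1)) y : ℝ) (c₂ ε ξ * f) with h | h
      · exact .inl ⟨hY y hy, h⟩
      · exact .inr ⟨by linarith [hY y hy], not_lt.2 (hno y hy), h⟩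
    have h₁ := Set.ncard_le_ncard hsub (Set.toFinite _)
    have h₂ := Set.ncard_union_le (cleanBall f ε ξ (Hs (k + 1)) w (2 * rad k))
      {u | dist w u ≤ 6 * rad k ∧ ¬ IsSaturated f ε ξ (Hs k) u ∧
        c₂ ε ξ * f ≤ deg (Hs (k + 1)) u}
    omega
  -- the slack `4λrₘ` in the distance pays for the steps to points that pass the threshold later
  set Q : ℕ → X → Prop := fun m z => m < k ∧ (deg (Hs m) z : ℝ) < c₂ ε ξ * f ∧
    c₂ ε ξ * f ≤ deg (Hs (m + 1)) z ∧ c₃ ε ξ * f < deg (Hs k) z ∧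
    dist w z ≤ rad k / 10 + 4 * (lam ε * rad m) with hQ
  have hexQ : ∃ m z, Q m z := by
    have hcard : 2 * (3 * f + 2) ≤ ((Hs (k - levelGap ε)).neighborSet w).ncard := by
      have h₁ := hR.deg_succ_le hA hk w
      have h₂ := hR.deg_le_deg_sub hA hk.le w
      have h₃ : (2 * (3 * f + 2) : ℝ) ≤ deg (Hs (k - levelGap ε)) w := by linarith
      exact_mod_cast h₃
    obtain ⟨z, hz, hzs⟩ := hsat _ (fun y hy => by linarith [hR.dist_le_of_adj hA hk.le hy]) hcard
    obtain ⟨m, -, hm, h₁, h₂⟩ := exists_promotion (f := f) (ε := ε) (ξ := ξ) (Hs := Hs) (z := z)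
      (Nat.zero_le k) (by rw [hR.1, deg_bot, Nat.cast_zero, hc₂]; linarith) (by linarith)
    refine ⟨m, z, hm, h₁, h₂, hzs, ?_⟩
    have h₃ := hR.dist_le_of_adj hA hk.le hz
    have := rad_pos m
    have : 0 ≤ lam ε * rad m := by nlinarith
    linarith
  obtain ⟨m, ⟨z, hz⟩, hmax⟩ : ∃ m, (∃ z, Q m z) ∧ ∀ m' z', Q m' z' → m' ≤ m := by
    have hbdd : BddAbove {m | ∃ z, Q m z} := ⟨k, fun m ⟨z, hz⟩ => hz.1.le⟩
    exact ⟨_, Nat.sSup_mem hexQ hbdd, fun m' z' h => le_csSup hbdd ⟨z', h⟩⟩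
  obtain ⟨hmk, hz₁, hz₂, hzs, hwz⟩ := hz
  have hmk' : 4 * logLam ε + m < k := by
    have h₁ := hR.deg_le_add hA hmk.le hk.le z
    have h₂ : 4 * logLam ε * (ξ * f) < (k - m) * (ξ * f) := by linarith
    have := lt_of_mul_lt_mul_right h₂ (by linarith)
    linarith
  have hrm : 125 * (lam ε * rad m) ≤ rad k := hA.lam_mul_rad_le (by linarith)
  have hmk'' : m + 1 ≤ k - levelGap ε := by
    have h₁ : ((m + 1 + levelGap ε : ℕ) : ℝ) ≤ k := by push_cast; linarith [hA.levelGap_le]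
    have h₂ : m + 1 + levelGap ε ≤ k := by exact_mod_cast h₁
    omega
  obtain ⟨z', ⟨hz'adj, hz'new⟩, hz's⟩ :
      ∃ z' ∈ (Hs (k - levelGap ε)).neighborSet z \ (Hs (m + 1)).neighborSet z,
        c₃ ε ξ * f < deg (Hs k) z' := by
    refine hsat _ (fun y hy => ?_) ?_
    · have h₁ := hR.dist_le_of_adj hA hk.le hy.1
      linarith [dist_triangle w z y]
    · have h₁ := hR.deg_succ_le hA (by omega : m < topLevel X) z
      have h₂ := hR.deg_le_deg_sub hA hk.le z
      have h₃ := Set.le_ncard_sdiff ((Hs (m + 1)).neighborSet z)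
        ((Hs (k - levelGap ε)).neighborSet z)
      have h₄ : (deg (Hs (m + 1)) z + 2 * (3 * f + 2) : ℝ) ≤ deg (Hs (k - levelGap ε)) z := by
        linarith
      have h₅ : deg (Hs (m + 1)) z + 2 * (3 * f + 2) ≤ deg (Hs (k - levelGap ε)) z := by
        exact_mod_cast h₄
      unfold deg at h₅
      omega
  obtain ⟨j, hmj, hjk, hadj, hnadj⟩ := exists_new_adj hz'adj hz'new hmk''
  obtain ⟨hd₁, hd₂⟩ := hR.dist_of_new_adj hA (by omega) hadj hnadj
  replace hd₂ := hd₂ (by omega)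
  have hrj := rad_pos j
  have hrj' : 125 * (lam ε * rad j) ≤ rad k := hA.lam_mul_rad_le_of_lt hjk
  have hlamj : 1000 * rad j ≤ lam ε * rad j := by nlinarith
  have hlammj : 5 * (lam ε * rad m) ≤ lam ε * rad j := by
    nlinarith [rad_mul_five_le (show m < j from hmj)]
  have hlater : ∀ y, (deg (Hs j) y : ℝ) < c₂ ε ξ * f → c₃ ε ξ * f < deg (Hs k) y →
      dist z y ≤ (lam ε + 34) * rad j → False := by
    intro y hy hys hzy
    obtain ⟨m', hjm', hm'k, h₁, h₂⟩ := exists_promotion (by omega : j ≤ k) hy (by linarith)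
    have h₃ : lam ε * rad j ≤ lam ε * rad m' := by
      have := rad_mono hjm'
      have : 0 ≤ lam ε := by linarith
      gcongr
    have := hmax m' y ⟨hm'k, h₁, h₂, hys, by linarith [dist_triangle w z y]⟩
    omega
  have hz'j : c₂ ε ξ * f ≤ deg (Hs j) z' := by
    by_contra hlt
    exact hlater z' (not_le.1 hlt) hz's (by linarith)
  have hzj : c₂ ε ξ * f ≤ deg (Hs j) z := hz₂.trans (hR.deg_mono hmj (by omega) z)
  have hC := hP j (by omega) z (by linarith)
  have hC' := hP j (by omega) z' (by linarith)
  have hdisj : Disjoint (cleanBall f ε ξ (Hs j) z (2 * rad j))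
      (cleanBall f ε ξ (Hs j) z' (2 * rad j)) := by
    rw [Set.disjoint_left]
    intro y hy hy'
    linarith [dist_triangle_right z z' y, hy.1, hy'.1]
  have hdist : ∀ y ∈ cleanBall f ε ξ (Hs j) z (2 * rad j) ∪ cleanBall f ε ξ (Hs j) z' (2 * rad j),
      dist z y ≤ (lam ε + 34) * rad j := by
    rintro y (hy | hy)
    · linarith [hy.1]
    · linarith [dist_triangle z z' y, hy.1]
  obtain ⟨y, hy, hys⟩ := hsat
    (cleanBall f ε ξ (Hs j) z (2 * rad j) ∪ cleanBall f ε ξ (Hs j) z' (2 * rad j))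
    (fun y hy => by linarith [hdist y hy, dist_triangle w z y])
    (by rw [Set.ncard_union_eq hdisj]; omega)
  exact hlater y (hy.elim (fun h => h.2) (fun h => h.2)) hys (hdist y hy)

/-- A point of degree more than `c₁ f` has many neighbours that are close to it.  Either they are
all clean, or one of them is past the threshold `c₂ f`; this one had degree more than `c₁ f` already
one iteration earlier, so that it has many clean points around it by induction. -/
theorem cleanAbundant [Finite X] (hA : Admissible X d ε ξ f) {i : ℕ} (hi : i ≤ topLevel X) :
    CleanAbundant f ε ξ (Hs i) i := by
  induction i using Nat.strong_induction_on with
  | _ i ih =>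
  intro v hv
  obtain rfl | ⟨k, rfl⟩ : i = 0 ∨ ∃ k, i = k + 1 := by
    cases i with
    | zero => exact .inl rfl
    | succ k => exact .inr ⟨k, rfl⟩
  · rw [hR.1, deg_bot, Nat.cast_zero] at hv
    exact absurd hv (not_lt.2 hA.c₁_nonneg)
  have hrk := rad_pos k
  have hL := hA.logLam_ge
  have hD := hA.one_le_xi_mul
  have hfD := hA.f_le_xi_mul
  have h12 := hA.c₁_add_le
  have hc₁ : c₁ ε ξ * f = 50 * (logLam ε * (ξ * f)) := by unfold c₁; ring
  have hLD : 20 * (ξ * f) ≤ logLam ε * (ξ * f) := by gcongr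
  have hP : ∀ j ≤ k, CleanAbundant f ε ξ (Hs j) j := fun j hj => ih j (by omega) (by omega)
  have hold : ∀ v', c₁ ε ξ * f < deg (Hs k) v' →
      3 * f + 2 ≤ (cleanBall f ε ξ (Hs (k + 1)) v' (4 * rad k)).ncard := by
    intro v' hv'
    by_cases hprom : ∃ w ∈ cleanBall f ε ξ (Hs k) v' (2 * rad k), c₂ ε ξ * f ≤ deg (Hs (k + 1)) w
    · obtain ⟨w, hw, hw'⟩ := hprom
      refine (hR.le_ncard_cleanBall_of_promoted hA hi hP hw.2 hw').trans
        (Set.ncard_le_ncard (fun y hy => ⟨?_, hy.2⟩) (Set.toFinite _))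
      linarith [hw.1, hy.1, dist_triangle v' w y]
    · push Not at hprom
      exact (hP k le_rfl v' hv').trans (Set.ncard_le_ncard
        (fun y hy => ⟨by linarith [hy.1], hprom y hy⟩) (Set.toFinite _))
  have hN : ∀ u, (Hs (k + 1 - levelGap ε)).Adj v u → dist v u ≤ rad (k + 1) / 10 :=
    fun u hu => hR.dist_le_of_adj hA hi hu
  rw [rad_succ] at hN ⊢
  by_cases hclean : ∀ u, (Hs (k + 1 - levelGap ε)).Adj v u → (deg (Hs (k + 1)) u : ℝ) < c₂ ε ξ * f
  · have h₁ := hR.deg_le_deg_sub hA hi v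
    have h₂ : (3 * f + 2 : ℝ) ≤ deg (Hs (k + 1 - levelGap ε)) v := by linarith
    have h₃ : 3 * f + 2 ≤ deg (Hs (k + 1 - levelGap ε)) v := by exact_mod_cast h₂
    exact h₃.trans (Set.ncard_le_ncard
      (fun u hu => ⟨by linarith [hN u hu], hclean u hu⟩) (Set.toFinite _))
  · push Not at hclean
    obtain ⟨v', hv', hdeg⟩ := hclean
    refine (hold v' (by linarith [hR.deg_succ_le hA hi v'])).trans
      (Set.ncard_le_ncard (fun y hy => ⟨?_, hy.2⟩) (Set.toFinite _))
    linarith [hN v' hv', hy.1, dist_triangle v v' y]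

/-- The surrogate sets of the nodes that are not small have `f + 1` points. -/
theorem ncard_eq_of_not_isSmall [Finite X] (hA : Admissible X d ε ξ f) {i : ℕ}
    (hi : i ≤ topLevel X) {x : X} (hx : ¬ IsSmall T f ε ξ (Hs i) i x) {Hc : SimpleGraph X}
    {S : Set X} (hS : IsSurrogateSet T f ε ξ (Hs i) Hc i x S) :
    S.ncard = f + 1 := by
  rcases le_or_gt (f + 1) (semiSaturated f ε ξ (Hs i) Hc i x).ncard with h | h
  · exact ((hS.2 hx).1 h).2
  obtain ⟨v, hv, hvd⟩ : ∃ v ∈ T.leaves i x, c₁ ε ξ * f < deg (Hs i) v := by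
    unfold IsSmall at hx
    push Not at hx
    exact hx
  have hr := rad_pos i
  have hxv := T.dist_leaf_le hi hv
  have hmany := hR.cleanAbundant hA hi v hvd
  have hsub : cleanBall f ε ξ (Hs i) v (2 * rad i) ⊆
      semiSaturated f ε ξ (Hs i) Hc i x ∪ clean f ε ξ Hc i x := by
    intro u hu
    have hxu : dist x u ≤ 4 * rad i := by linarith [hu.1, dist_triangle x v u]
    rcases lt_or_ge (deg Hc u : ℝ) (c₂ ε ξ * f) with hd | hd
    · exact .inr ⟨hxu, hd⟩
    · exact .inl ⟨by linarith, hd, not_lt.2 (hu.2.le.trans hA.c₂_le_c₃)⟩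
  have h₁ := Set.ncard_le_ncard hsub (Set.toFinite _)
  have h₂ := Set.ncard_union_le (semiSaturated f ε ξ (Hs i) Hc i x) (clean f ε ξ Hc i x)
  obtain ⟨A, hAc, hA', rfl⟩ := (hS.2 hx).2 h
  have hdisj : Disjoint (semiSaturated f ε ξ (Hs i) Hc i x) A := by
    rw [Set.disjoint_left]
    intro u hu hu'
    exact absurd hu.2.1 (not_le.2 (hAc hu').2)
  rw [Set.ncard_union_eq hdisj, hA']
  omega

end IsRun

end Abundance

/-! ### Edges that survive the faults -/

section Survival

variable {X : Type*} [MetricSpace X] {T : NetTree X} {G : SimpleGraph X} {f : ℕ} {d ε ξ : ℝ}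
  {Hs : ℕ → SimpleGraph X} {F : Finset X}

/-- The surrogate sets of the node `(x, i)` cannot fail completely, as the node is not small or has
a leaf outside `F`. -/
def IsAlive (T : NetTree X) (f : ℕ) (ε ξ : ℝ) (F : Finset X) (Hᵢ : SimpleGraph X) (i : ℕ)
    (x : X) : Prop :=
  ¬ IsSmall T f ε ξ Hᵢ i x ∨ ∃ v ∈ T.leaves i x, v ∉ F

theorem exists_notMem_of_ncard {X : Type*} {F : Finset X} {f : ℕ} {S : Set X} (hF : F.card ≤ f)
    (hS : f + 1 ≤ S.ncard) : ∃ s ∈ S, s ∉ F :=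
  Set.exists_mem_notMem_of_ncard_lt_ncard (s := (F : Set X)) (by rw [Set.ncard_coe_finset]; omega)

theorem IsAlive.of_leaf {Hᵢ : SimpleGraph X} {i : ℕ} {v : X} (hv : v ∉ F) :
    IsAlive T f ε ξ F Hᵢ i (T.ancestor 0 i v) :=
  .inr ⟨v, rfl, hv⟩

theorem IsAlive.exists_notMem [Finite X] (hA : Admissible X d ε ξ f) (hR : IsRun T G f ε ξ Hs)
    (hF : F.card ≤ f) {i : ℕ} (hi : i ≤ topLevel X) {x : X}
    (hx : IsAlive T f ε ξ F (Hs i) i x) {Hc : SimpleGraph X} {S : Set X}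
    (hS : IsSurrogateSet T f ε ξ (Hs i) Hc i x S) : ∃ s ∈ S, s ∉ F := by
  by_cases hs : IsSmall T f ε ξ (Hs i) i x
  · obtain ⟨v, hv, hvF⟩ := hx.resolve_left (not_not.2 hs)
    obtain ⟨hsub, hcard⟩ := hS.1 hs
    rcases le_or_gt (f + 1) (T.leaves i x).ncard with h | h
    · exact exists_notMem_of_ncard hF (by rw [hcard, min_eq_left h])
    · rw [min_eq_right h.le] at hcard
      exact ⟨v, by rwa [Set.eq_of_subset_of_ncard_le hsub hcard.ge], hvF⟩
  · exact exists_notMem_of_ncard hF (hR.ncard_eq_of_not_isSmall hA hi hs hS).ge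

theorem IsAlive.exists_near [Finite X] (hA : Admissible X d ε ξ f) (hR : IsRun T G f ε ξ Hs)
    (hF : F.card ≤ f) {i : ℕ} (hi : i ≤ topLevel X) {x : X}
    (hx : IsAlive T f ε ξ F (Hs i) i x) : ∃ s ∉ F, dist x s ≤ 16 * rad i := by
  obtain ⟨S, hS⟩ := exists_isSurrogateSet T f ε ξ (Hs i) (Hs i) i x
  obtain ⟨s, hs, hsF⟩ := hx.exists_notMem hA hR hF hi hS
  exact ⟨s, hsF, hS.dist_le hi hs⟩

/-- Each point of `F` destroys at most one edge of a perfect matching of disjoint sets. -/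
theorem IsBipartiteConnection.exists_notMem {X : Type*} {F : Finset X} {f : ℕ} {S₁ S₂ : Set X}
    {M : Set (Sym2 X)} (h : IsBipartiteConnection f S₁ S₂ M) (hF : F.card ≤ f)
    (hdisj : Disjoint S₁ S₂) (h₁ : ∃ s ∈ S₁, s ∉ F) (h₂ : ∃ s ∈ S₂, s ∉ F) :
    ∃ s ∈ S₁, ∃ s' ∈ S₂, s ∉ F ∧ s' ∉ F ∧ s(s, s') ∈ M := by
  classical
  rcases lt_or_ge (min S₁.ncard S₂.ncard) (f + 1) with hlt | hge
  · obtain ⟨s, hs, hsF⟩ := h₁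
    obtain ⟨s', hs', hsF'⟩ := h₂
    exact ⟨s, hs, s', hs', hsF, hsF', by rw [h.1 hlt]; exact ⟨s, hs, s', hs', rfl⟩⟩
  · obtain ⟨φ, hφ, rfl⟩ := h.2 hge
    by_contra! hno
    have hfail : ∀ s ∈ S₁, s ∉ F → φ s ∈ F := fun s hs hsF => by
      by_contra hsF'
      exact hno s hs (φ s) (hφ.mapsTo hs) hsF hsF' ⟨s, hs, rfl⟩
    have hcross : ∀ s ∈ S₁, ∀ t ∈ S₁, s ≠ φ t := fun s hs t ht hst =>
      Set.disjoint_left.1 hdisj hs (hst ▸ hφ.mapsTo ht)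
    have hcard : S₁.ncard ≤ F.card := by
      rw [← Set.ncard_coe_finset F]
      refine Set.ncard_le_ncard_of_injOn (fun s => if s ∈ F then s else φ s) (fun s hs => ?_)
        (fun s hs t ht hst => ?_) F.finite_toSet
      · split_ifs with hsF
        · exact hsF
        · exact hfail s hs hsF
      · dsimp only at hst
        split_ifs at hst with hsF htF htF
        · exact hst
        · exact absurd hst (hcross s hs t ht)
        · exact absurd hst.symm (hcross t ht s hs)
        · exact hφ.injOn hs ht hst
    have := hge.trans (min_le_left _ _)
    omega

/-- A processed cross edge between two alive nodes is realized by an edge of `H - F`. -/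
theorem IsRun.exists_adj_of_mem_EStar [Finite X] (hA : Admissible X d ε ξ f)
    (hR : IsRun T G f ε ξ Hs) (hF : F.card ≤ f) {i : ℕ} (hi : i < topLevel X) {x y : X}
    (he : s(x, y) ∈ EStar T G f ε ξ Hs i) (hxy : 64 * rad i ≤ dist x y)
    (hx : IsAlive T f ε ξ F (Hs i) i x) (hy : IsAlive T f ε ξ F (Hs i) i y) :
    ∃ s ∉ F, ∃ s' ∉ F, dist x s ≤ 16 * rad i ∧ dist y s' ≤ 16 * rad i ∧
      (Hs (topLevel X)).Adj s s' := by
  obtain ⟨l, -, hmem, h⟩ := hR.2 i hi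
  obtain ⟨q, hq, hqe⟩ := List.mem_map.1 ((hmem _).2 he)
  obtain ⟨Hd, S₁, S₂, M, h₁, h₂, hM, hle⟩ := h.exists_of_mem hq
  have hr := rad_pos i
  have key : ∀ {a b : X}, 64 * rad i ≤ dist a b → IsAlive T f ε ξ F (Hs i) i a →
      IsAlive T f ε ξ F (Hs i) i b → IsSurrogateSet T f ε ξ (Hs i) Hd i a S₁ →
      IsSurrogateSet T f ε ξ (Hs i) Hd i b S₂ → ∃ s ∉ F, ∃ s' ∉ F, dist a s ≤ 16 * rad i ∧
        dist b s' ≤ 16 * rad i ∧ (Hs (topLevel X)).Adj s s' := by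
    intro a b hab ha hb h₁ h₂
    have hdisj : Disjoint S₁ S₂ := by
      rw [Set.disjoint_left]
      intro s hs hs'
      linarith [h₁.dist_le hi.le hs, h₂.dist_le hi.le hs', dist_triangle_right a b s]
    obtain ⟨s, hs, s', hs', hsF, hsF', hM'⟩ := hM.exists_notMem hF hdisj
      (ha.exists_notMem hA hR hF hi.le h₁) (hb.exists_notMem hA hR hF hi.le h₂)
    refine ⟨s, hsF, s', hsF', h₁.dist_le hi.le hs, h₂.dist_le hi.le hs', hR.mono hi le_rfl
      (hle ((SimpleGraph.fromEdgeSet_adj M).2 ⟨hM', fun e => ?_⟩))⟩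
    exact Set.disjoint_left.1 hdisj hs (e ▸ hs')
  rcases Sym2.eq_iff.1 hqe with ⟨e₁, e₂⟩ | ⟨e₁, e₂⟩
  · rw [e₁] at h₁
    rw [e₂] at h₂
    exact key hxy hx hy h₁ h₂
  · rw [e₁] at h₁
    rw [e₂] at h₂
    rw [dist_comm] at hxy
    obtain ⟨s, hs, s', hs', hd, hd', hadj⟩ := key hxy hy hx h₁ h₂
    exact ⟨s', hs', s, hs, hd', hd, hadj.symm⟩

end Survival

/-! ### Stretch -/

section Stretch

variable {X : Type*} [MetricSpace X] {T : NetTree X} {G H : SimpleGraph X} {f : ℕ} {d ε ξ B D : ℝ}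
  {Hs : ℕ → SimpleGraph X} {F : Finset X}

/-- Near `p` and near `q` there are points outside `F` that are joined in `H - F` at a cost of at
most `(1 + ε) W`.  This cost includes a reserve proportional to the distances of these points from
`p` and `q`, which pays for the connection to the continuations of the path at its ends. -/
def Linked (H : SimpleGraph X) (F : Finset X) (ε B : ℝ) (p q : X) (W : ℝ) : Prop :=
  ∃ ρ ρ' s s', 0 ≤ ρ ∧ 0 ≤ ρ' ∧ ρ ≤ B ∧ ρ' ≤ B ∧ dist p s ≤ 18 * ρ ∧ dist q s' ≤ 18 * ρ' ∧
    s ∉ F ∧ s' ∉ F ∧ Joined H F s s' ((1 + ε) * W - 80 * (ρ + ρ'))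

theorem Linked.trans
    (hshort : ∀ a b, a ∉ F → b ∉ F → dist a b ≤ 36 * B → Joined H F a b (2 * dist a b))
    {p q r : X} {W W' : ℝ} (h : Linked H F ε B p q W) (h' : Linked H F ε B q r W') :
    Linked H F ε B p r (W + W') := by
  obtain ⟨ρ₁, ρ₂, s₁, s₂, h₁, h₂, hB₁, hB₂, hs₁, hs₂, hF₁, hF₂, hJ⟩ := h
  obtain ⟨ρ₃, ρ₄, s₃, s₄, h₃, h₄, hB₃, hB₄, hs₃, hs₄, hF₃, hF₄, hJ'⟩ := h'
  have hd : dist s₂ s₃ ≤ 18 * ρ₂ + 18 * ρ₃ := by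
    have := dist_triangle_left s₂ s₃ q
    linarith
  refine ⟨ρ₁, ρ₄, s₁, s₄, h₁, h₄, hB₁, hB₄, hs₁, hs₄, hF₁, hF₄, ?_⟩
  refine ((hJ.trans (hshort s₂ s₃ hF₂ hF₃ (by linarith))).trans hJ').mono ?_
  linarith

/-- The original cross edge of `u` and `v` exists, and its level is at most every level at which
their ancestors are within cross distance. -/
theorem NetTree.exists_isOriginalLevel (T : NetTree X) {u v : X} {i : ℕ} (hi : i ≤ topLevel X)
    (h : dist (T.ancestor 0 i u) (T.ancestor 0 i v) ≤ lam ε * rad i) :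
    ∃ j ≤ i, T.IsOriginalLevel ε u v j := by
  classical
  have hex : ∃ j, dist (T.ancestor 0 j u) (T.ancestor 0 j v) ≤ lam ε * rad j := ⟨i, h⟩
  have hle := Nat.find_min' hex h
  exact ⟨Nat.find hex, hle, hle.trans hi, Nat.find_spec hex,
    fun j hj => not_le.1 (Nat.find_min hex hj)⟩

/-- A walk of `G` of weight comparable to `λ rᵢ` whose ends are alive at level `i` can be followed
in `H - F`.  If the cross edge of its ends is processed, one of the edges that realize it survives.
Otherwise all nodes along the walk are alive at the previous level and all edges of the walk are
short, so that the walk can be cut into pieces of the previous level. -/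
theorem IsRun.linked_of_walk [Finite X] (hA : Admissible X d ε ξ f) (hR : IsRun T G f ε ξ Hs)
    (hF : F.card ≤ f)
    (hshort : ∀ a b, a ∉ F → b ∉ F → dist a b ≤ D / 2 →
      Joined (Hs (topLevel X)) F a b (2 * dist a b))
    {i : ℕ} (hi : i < topLevel X) {p q : X} (π : G.Walk p q)
    (hπ : lam ε * rad i < 50 * walkWeight π) (hπ' : 5 * walkWeight π ≤ lam ε * rad i)
    (hπD : walkWeight π ≤ 2 * D) (hp : IsAlive T f ε ξ F (Hs i) i (T.ancestor 0 i p))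
    (hq : IsAlive T f ε ξ F (Hs i) i (T.ancestor 0 i q)) :
    Linked (Hs (topLevel X)) F ε (D / 100) p q (walkWeight π) := by
  induction i using Nat.strong_induction_on generalizing p q with
  | _ i ih =>
  have hr := rad_pos i
  have hlam := hA.lam_ge
  have hε := hA.eps_pos
  have hεlam := le_mul_lam hε
  set W := walkWeight π with hW
  set x := T.ancestor 0 i p with hx
  set y := T.ancestor 0 i q with hy
  have hrW : 1000 * rad i ≤ W := by nlinarith
  have hrW' : 1000 * rad i ≤ ε * W := by nlinarith
  have hrD : 10000 * rad i ≤ D := by nlinarith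
  have hpx := T.dist_ancestor_le p hi.le
  have hqy := T.dist_ancestor_le q hi.le
  have hxy : dist x y ≤ W + 5 / 2 * rad i := by
    linarith [T.dist_ancestor_ancestor_le p q hi.le, dist_le_walkWeight π]
  rcases lt_or_ge (dist x y) (64 * rad i) with hclose | hfar
  · obtain ⟨s, hsF, hs⟩ := hp.exists_near hA hR hF hi.le
    obtain ⟨s', hsF', hs'⟩ := hq.exists_near hA hR hF hi.le
    have hss' : dist s s' ≤ 96 * rad i := by
      have := dist_triangle4 s x y s'
      rw [dist_comm s x] at this
      linarith
    exact ⟨rad i, rad i, s, s', hr.le, hr.le, by linarith, by linarith,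
      by linarith [dist_triangle p x s], by linarith [dist_triangle q y s'], hsF, hsF',
      (hshort s s' hsF hsF' (by linarith)).mono (by linarith)⟩
  by_cases he : s(x, y) ∈ EStar T G f ε ξ Hs i
  · obtain ⟨s, hsF, s', hsF', hs, hs', hadj⟩ := hR.exists_adj_of_mem_EStar hA hF hi he hfar hp hq
    have hss' : dist s s' ≤ dist x y + 32 * rad i := by
      have := dist_triangle4 s x y s'
      rw [dist_comm s x] at this
      linarith
    exact ⟨rad i, rad i, s, s', hr.le, hr.le, by linarith, by linarith,
      by linarith [dist_triangle p x s], by linarith [dist_triangle q y s'], hsF, hsF',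
      (Joined.of_adj hsF hsF' hadj).mono (by linarith)⟩
  have hxyle : dist x y ≤ lam ε * rad i := by nlinarith
  have hnet : ∀ v ∈ π.support,
      x ∈ T.NC ε i (T.ancestor 0 i v) ∧ y ∈ T.NC ε i (T.ancestor 0 i v) := by
    intro v hv
    have h₁ := T.dist_ancestor_ancestor_le v p hi.le
    have h₂ := T.dist_ancestor_ancestor_le v q hi.le
    have h₃ := dist_le_walkWeight_of_mem_support π v hv
    have h₄ := dist_le_walkWeight_of_mem_support_right π v hv
    rw [dist_comm v p] at h₁
    exact ⟨⟨T.ancestor_mem p hi.le, by linarith⟩, ⟨T.ancestor_mem q hi.le, by linarith⟩⟩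
  have hL := hA.logLam_ge
  -- the second phase has not found a small node with at most `f` leaves on the walk
  have hbig : ∀ v ∈ π.support, ∀ k ≤ i, (i : ℝ) - 5 * logLam ε ≤ k →
      IsSmall T f ε ξ (Hs k) k (T.ancestor 0 k v) →
      f < (T.leaves k (T.ancestor 0 k v)).ncard := by
    intro v hv k hk hkL hs
    by_contra! hcard
    refine he (.inr ⟨T.ancestor 0 i v, T.ancestor_mem v hi.le, ⟨k, hk, hkL, T.ancestor 0 k v,
      T.ancestor_mem v (by omega), ?_, hs, hcard⟩, x, (hnet v hv).1, y, (hnet v hv).2, hfar, hxyle,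
      rfl⟩)
    rw [← T.ancestor_add, Nat.add_sub_cancel' hk]
  obtain rfl | ⟨k, rfl⟩ : i = 0 ∨ ∃ k, i = k + 1 := by
    cases i with
    | zero => exact .inl rfl
    | succ k => exact .inr ⟨k, rfl⟩
  · have := hbig p π.start_mem_support 0 le_rfl (by push_cast; linarith) fun v _ => by
      rw [hR.1, deg_bot, Nat.cast_zero]; exact hA.c₁_nonneg
    rw [T.leaves_zero, Set.ncard_singleton] at this
    have := hA.one_le_f
    omega
  have halive : ∀ v ∈ π.support, IsAlive T f ε ξ F (Hs k) k (T.ancestor 0 k v) := by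
    intro v hv
    by_cases hs : IsSmall T f ε ξ (Hs k) k (T.ancestor 0 k v)
    · exact .inr (exists_notMem_of_ncard hF (hbig v hv k k.le_succ (by push_cast; linarith) hs))
    · exact .inl hs
  -- the first phase has not found an edge of the walk whose original level is close to `k + 1`
  have hedge : ∀ e ∈ π.darts, dist e.fst e.snd ≤ lam ε * rad k / 50 := by
    intro e hed
    have hle : dist (T.ancestor 0 (k + 1) e.fst) (T.ancestor 0 (k + 1) e.snd) ≤
        lam ε * rad (k + 1) := by
      linarith [T.dist_ancestor_ancestor_le e.fst e.snd hi.le,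
        dist_le_walkWeight_of_mem_darts π e hed]
    obtain ⟨j, hj, horig⟩ := T.exists_isOriginalLevel hi.le hle
    have hjk : (j : ℝ) + 5 * logLam ε < (k + 1 : ℕ) := by
      by_contra! hge
      refine he (.inl ⟨e.fst, e.snd, j, e.adj, horig, .inr ⟨hj, hi.le, hge, .inl ?_, x, y, rfl,
        hfar⟩⟩)
      obtain ⟨hxv, hyv⟩ := hnet e.fst (π.dart_fst_mem_support_of_mem_darts hed)
      unfold NetTree.aug
      rw [← T.ancestor_add, Nat.add_sub_cancel' hj]
      exact ⟨x, hxv, y, hyv, hxv.1, hyv.1, hxyle, rfl⟩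
    have h₁ := T.dist_le_dist_ancestor e.fst e.snd horig.1
    have h₂ := horig.2.1
    have h₃ := FTSpanner.lam_mul_rad_le hA.eps_pos hA.eps_le (i := j + 3) (j := k + 1)
      (by push_cast at hjk ⊢; linarith)
    rw [rad_add] at h₃
    rw [rad_succ] at h₃
    nlinarith [rad_pos j, rad_pos k]
  have hrk := rad_pos k
  rw [rad_succ] at hπ
  have hlamk : 0 ≤ lam ε * rad k := by nlinarith
  refine walk_induction_pieces (R := Linked (Hs (topLevel X)) F ε (D / 100))
    (P := fun v => IsAlive T f ε ξ F (Hs k) k (T.ancestor 0 k v)) (θ := lam ε * rad k / 50)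
    (B := 2 * D) (Linked.trans fun a b ha hb hab => hshort a b ha hb (by linarith)) (by linarith)
    (fun π' ha hb h₁ h₂ h₃ => ?_) π hedge halive (by linarith) hπD
  exact ih k k.lt_succ_self (by omega) π' (by linarith) (by linarith) h₃ ha hb

theorem dist_le_five_pow_topLevel [Finite X] (u v : X) : dist u v ≤ 5 ^ topLevel X := by
  have hd : dist u v ≤ Metric.diam (Set.univ : Set X) :=
    Metric.dist_le_diam_of_mem (Set.toFinite _).isBounded (Set.mem_univ u) (Set.mem_univ v)
  refine hd.trans ?_
  rcases Metric.diam_nonneg.eq_or_lt (a := (0 : ℝ)) (b := Metric.diam (Set.univ : Set X)) with h | h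
  · rw [← h]; positivity
  · rw [← Real.rpow_natCast, ← Real.logb_le_iff_le_rpow (by norm_num) h]
    exact Nat.le_ceil _

/-- Points at distance at most `λ` are adjacent, as the nodes at level `0` are small and have a
single leaf. -/
theorem IsRun.adj_of_dist_le_lam [Finite X] (hA : Admissible X d ε ξ f)
    (hR : IsRun T G f ε ξ Hs) {u v : X} (huv : u ≠ v) (h : dist u v ≤ lam ε) :
    (Hs (topLevel X)).Adj u v := by
  have hsep := hA.sep u v huv
  have hζ : 0 < topLevel X := by
    by_contra h0
    have := dist_le_five_pow_topLevel u v
    rw [Nat.eq_zero_of_not_pos h0, pow_zero] at this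
    linarith
  have hlam := hA.lam_ge
  have hL := hA.logLam_ge
  have hmem : ∀ z, z ∈ T.net 0 := by simp [T.net_zero]
  have hrad : rad 0 = 1 := by simp [rad]
  have he : s(u, v) ∈ EStar T G f ε ξ Hs 0 := by
    refine .inr ⟨u, hmem u, ⟨0, le_rfl, by push_cast; linarith, u, hmem u, rfl, fun z _ => ?_, ?_⟩,
      u, ⟨hmem u, ?_⟩, v, ⟨hmem v, ?_⟩, ?_, ?_, rfl⟩
    · rw [hR.1, deg_bot, Nat.cast_zero]; exact hA.c₁_nonneg
    · rw [T.leaves_zero, Set.ncard_singleton]; exact hA.one_le_f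
    · rw [dist_self, hrad]; linarith
    all_goals rw [hrad]; linarith
  have halive : ∀ z, IsAlive T f ε ξ ∅ (Hs 0) 0 z := fun z => .inr ⟨z, rfl, Finset.notMem_empty z⟩
  obtain ⟨s, -, s', -, hs, hs', hadj⟩ := hR.exists_adj_of_mem_EStar hA (F := ∅) (by simp) hζ he
    (by rw [hrad]; linarith) (halive u) (halive v)
  rw [hrad] at hs hs'
  have hus : u = s := by
    by_contra hne
    linarith [hA.sep u s hne]
  have hvs : v = s' := by
    by_contra hne
    linarith [hA.sep v s' hne]
  rwa [hus, hvs]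

/-- Induction on the distance of `u` and `v`: follow a light path of `G` from `u` to `v`. -/
theorem IsRun.joined [Finite X] (hA : Admissible X d ε ξ f) (hR : IsRun T G f ε ξ Hs)
    (hG : IsSpanner G (1 + ε)) (hF : F.card ≤ f) (u v : X) (hu : u ∉ F) (hv : v ∉ F) :
    Joined (Hs (topLevel X)) F u v ((1 + 5 * ε) * dist u v) := by
  by_contra hno
  obtain ⟨⟨u, v⟩, ⟨hu, hv, hno⟩, hmin⟩ := Set.exists_min_image
    {q : X × X | q.1 ∉ F ∧ q.2 ∉ F ∧
      ¬ Joined (Hs (topLevel X)) F q.1 q.2 ((1 + 5 * ε) * dist q.1 q.2)}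
    (fun q => dist q.1 q.2) (Set.toFinite _) ⟨(u, v), hu, hv, hno⟩
  dsimp only at hu hv hno hmin
  have hε := hA.eps_pos
  have hε' := hA.eps_le
  have hlam := hA.lam_ge
  apply hno
  rcases eq_or_ne u v with rfl | huv
  · exact (Joined.refl hu).mono (by simp)
  set D := dist u v with hD
  have hD64 : 64 ≤ D := hA.sep u v huv
  rcases le_or_gt D (lam ε) with hle | hlt
  · exact (Joined.of_adj hu hv (hR.adj_of_dist_le_lam hA huv hle)).mono (by nlinarith)
  have hshort : ∀ a b, a ∉ F → b ∉ F → dist a b ≤ D / 2 →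
      Joined (Hs (topLevel X)) F a b (2 * dist a b) := by
    intro a b ha hb hab
    by_contra hnot
    have := hmin (a, b) ⟨ha, hb, fun h =>
      hnot (h.mono (by nlinarith [dist_nonneg (x := a) (y := b)]))⟩
    dsimp only at this
    linarith
  obtain ⟨π, hπ⟩ := hG u v
  have hDW : D ≤ walkWeight π := dist_le_walkWeight π
  have hlam0 : 0 < lam ε := by linarith
  obtain ⟨n, hn, hn'⟩ := exists_nat_pow_near (x := 5 * walkWeight π / lam ε) (y := 5)
    (by rw [le_div_iff₀ hlam0]; linarith) (by norm_num)
  rw [le_div_iff₀ hlam0] at hn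
  rw [div_lt_iff₀ hlam0] at hn'
  have hWD : walkWeight π ≤ 2 * D := by nlinarith
  have hn₁ : lam ε * rad (n + 1) ≤ 25 * walkWeight π := by
    unfold rad
    rw [pow_succ]
    linarith
  have hnζ : n + 1 < topLevel X := by
    have h₁ : lam ε * rad (n + 1) ≤ 50 * 5 ^ topLevel X := by
      linarith [dist_le_five_pow_topLevel u v]
    have h₂ : (5 : ℝ) ^ (n + 1) < 5 ^ topLevel X := by
      have := rad_pos (n + 1)
      unfold rad at this h₁
      nlinarith
    exact (pow_lt_pow_iff_right₀ (by norm_num)).1 h₂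
  obtain ⟨ρ, ρ', s, s', h₁, h₂, hB₁, hB₂, hs, hs', hsF, hsF', hJ⟩ := hR.linked_of_walk hA hF
    hshort hnζ π (by linarith) (by unfold rad; linarith) hWD (.of_leaf hu) (.of_leaf hv)
  rw [dist_comm v s'] at hs'
  refine (((hshort u s hu hsF (by linarith)).trans hJ).trans
    (hshort s' v hsF' hv (by linarith))).mono ?_
  have h₃ : (1 + ε) * walkWeight π ≤ (1 + ε) * ((1 + ε) * D) := by gcongr
  have h₄ : (1 + ε) * ((1 + ε) * D) ≤ (1 + 5 * ε) * D := by
    rw [← mul_assoc]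
    gcongr
    nlinarith
  linarith

end Stretch

end FTSpanner

open FTSpanner in
theorem mainTheorem3 :
    ∃ C : ℝ, 0 < C ∧
      ∀ (X : Type*) [Fintype X] [MetricSpace X] (d ε ξ : ℝ) (f : ℕ)
        (T : NetTree X) (G : SimpleGraph X),
        DoublingDimLE X d →
        (∀ p q : X, p ≠ q → 64 ≤ dist p q) →
        0 < ε → ε ≤ 1 / 20 → 1 ≤ f → (C / ε) ^ d ≤ ξ →
        IsSpanner G (1 + ε) →
        (∃ H : SimpleGraph X, IsOutput T G f ε ξ H) ∧
        ∀ H : SimpleGraph X, IsOutput T G f ε ξ H → IsVFTSpanner H f (1 + 5 * ε) := by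
  refine ⟨8192 * 5 ^ 20, by positivity, ?_⟩
  intro X _ _ d ε ξ f T G hdim hsep hε hε' hf hξ hG
  refine ⟨?_, ?_⟩
  · obtain ⟨Hs, h₀, hstep⟩ := exists_isRun T G f ε ξ
    exact ⟨Hs (topLevel X), Hs, h₀, rfl, hstep⟩
  · rintro H ⟨Hs, h₀, rfl, hstep⟩
    -- a space with one point may have dimension `0`, so that packing says nothing about `ξ`
    rcases subsingleton_or_nontrivial X with hX | hX
    · refine isVFTSpanner_of_joined fun F _ u v hu _ => ?_
      obtain rfl := Subsingleton.elim u v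
      exact (FTSpanner.Joined.refl hu).mono (by simp)
    · have hd := hdim.one_le
      have hlam := le_lam hε hε'
      refine isVFTSpanner_of_joined fun F hF => IsRun.joined (d := d) (ξ := ξ) (T := T) (G := G)
        ⟨hdim, hsep, hε, hε', hf, hd, le_trans ?_ hξ⟩ ⟨h₀, hstep⟩ hG hF
      refine Real.rpow_le_rpow (by linarith) ?_ (by linarith)
      calc 4096 * lam ε ≤ 4096 * (2 * 5 ^ 20 / ε) := by gcongr; exact lam_le hε hε'
        _ = 8192 * 5 ^ 20 / ε := by ring
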